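/- For $\sigma\ge 0$, an entire function $F$ is said to be of exponential type at most $\sigma$ if for every $\delta>0$ there is $A_\delta$ such that $|F(z)|\le A_\delta e^{(\sigma+\delta)|z|}$ for all $z\in\mathbb C$. Let $n_F(R)$ denote the number of zeroes of $F$ in the closed disk $\{|z|\le R\}$, counted with multiplicities, and let the lower density of a set $X$ of non-negative integers be $\liminf_{N\to\infty}|X\cap[1,N]|/N$. Theorem. For every $d>0$ and every $\sigma\ge 0$ there exists $\chi>0$, depending only on $d$ and $\sigma$, such that the following holds. Let $$F(z)=\sum_{n\ge 0}\omega_n\frac{z^n}{n!}\qquad(\omega_n\in\mathbb C)$$ be an entire function of exponential type at most $\sigma$ such that the set $\{n\ge 0: |\omega_n|=1\}$ has lower density $d$. Then either $$\liminf_{R\to\infty}\frac{n_F(R)}{R}\ge\chi,$$ or there are $\Theta,\alpha\in\mathbb C$ with $|\Theta|=|\alpha|=1$ such that $F(z)=\Theta e^{\alpha z}$ for all $z\in\mathbb C$. -/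

import Mathlib

/-- `F` is an entire function of exponential type at most `σ`: it is entire and, for each `δ > 0`,
`|F z| ≤ A_δ * exp ((σ + δ) |z|)` on the whole plane. -/
structure IsExpTypeAtMost (σ : ℝ) (F : ℂ → ℂ) : Prop where
  entire : Differentiable ℂ F
  growth : ∀ δ : ℝ, 0 < δ → ∃ A : ℝ, ∀ z : ℂ, ‖F z‖ ≤ A * Real.exp ((σ + δ) * ‖z‖)

/-- The number of zeroes of `F` in the closed disk `{|z| ≤ R}`, counted with multiplicities.
(The sum has finite support as soon as `F` is entire and not identically zero.) -/
noncomputable def zeroCount (F : ℂ → ℂ) (R : ℝ) : ℕ :=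
  ∑ᶠ z ∈ Metric.closedBall (0 : ℂ) R, analyticOrderNatAt F z

/-- The lower density `liminf_{N → ∞} |X ∩ [1, N]| / N` of a set of non-negative integers
(the quotients lie in `[0, 1]`). -/
noncomputable def lowerDensity (X : Set ℕ) : ℝ :=
  Filter.liminf (fun N : ℕ => ((X ∩ Set.Icc 1 N).ncard : ℝ) / (N : ℝ)) Filter.atTop

/-! Suppose the density of zeroes is small along a sequence of radii R. Reflecting the zeroes of F
in the circle of radius R gives a zero-free function in the open disk that dominates F. By
Borel–Carathéodory its logarithm is linear up to a quadratic error, so for some c the function F(z)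
exp(-cz) is at most exp(εN) on a disk of radius AN, with N a small multiple of R
(`exists_frequently_norm_mul_exp_neg_le`).

By the Leibniz rule and Newton's expansion this means ω_n = c^n p(n) for n ≤ N, where p is a
polynomial of small exponential growth on |z| ≤ 7N (`exists_polynomial_eval_eq`). Many unimodular
ω_n force |c| close to 1. If |c| is too small, ω_n is too small at an index n comparable to N. If
|c| is too large, p is tiny at a positive proportion of integers, hence by interpolation on the
whole disk |z| ≤ N, contradicting |ω_n| = 1 at one fixed n (`exists_eventually_norm_mem_Icc`). So c
may be taken unimodular.

Then p(z) times its conjugate reflection, minus 1, vanishes at at least dN/2 integers, which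
outweighs its growth, so it is exponentially small on |z| ≤ N. Hence p is zero-free there, and on
bounded sets close to p(0) exp(bz). As N → ∞ this gives |ω_n| = 1 and ω_n ω_{n+2} = ω_{n+1}²
exactly, for every n (`unimodular_geometric_of_frequently`), so (ω_n) is a geometric progression and
F an exponential. -/

/-! ### Zero-free functions in a disk: the Borel–Carathéodory estimate. -/

open Metric Complex in
theorem exists_eq_mul_exp_of_ne_zero_ball {R : ℝ} (hR : 0 < R) {f : ℂ → ℂ}
    (hf : DifferentiableOn ℂ f (ball 0 R)) (h0 : ∀ z ∈ ball (0 : ℂ) R, f z ≠ 0) :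
    ∃ g : ℂ → ℂ, DifferentiableOn ℂ g (ball 0 R) ∧ g 0 = 0 ∧
      ∀ z ∈ ball (0 : ℂ) R, f z = f 0 * exp (g z) := by
  have hfd : DifferentiableOn ℂ (fun z => deriv f z / f z) (ball 0 R) :=
    (hf.deriv isOpen_ball).div hf h0
  obtain ⟨g, hg0, hg⟩ := hfd.isExactOn_ball.with_val_at 0 0
  have hmem : (0 : ℂ) ∈ ball (0 : ℂ) R := by simpa using hR
  refine ⟨g, fun z hz => (hg z hz).differentiableAt.differentiableWithinAt, hg0, fun z hz => ?_⟩
  have hder : ∀ w ∈ ball (0 : ℂ) R, HasDerivAt (fun z => f z * exp (-g z)) 0 w := by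
    intro w hw
    have h1 := (hf.differentiableAt (isOpen_ball.mem_nhds hw)).hasDerivAt
    have h2 := h1.mul ((hg w hw).neg.cexp)
    have h3 : f w * (deriv f w / f w) = deriv f w := mul_div_cancel₀ _ (h0 w hw)
    refine h2.congr_deriv ?_
    change deriv f w * exp (-g w) + f w * (exp (-g w) * -(deriv f w / f w)) = 0
    linear_combination -exp (-g w) * h3
  have hconst := isOpen_ball.is_const_of_deriv_eq_zero
    (convex_ball (0 : ℂ) R).isPreconnected
    (fun w hw => (hder w hw).differentiableAt.differentiableWithinAt)
    (fun w hw => (hder w hw).deriv) hz hmem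
  simp only [hg0, neg_zero, exp_zero, mul_one] at hconst
  rw [← hconst, mul_assoc, ← exp_add]
  simp

open Metric Complex in
/-- A zero-free function of moderate growth in a disk is nearly an exponential near the centre. -/
theorem exists_eq_mul_exp_linear {R M : ℝ} (hR : 0 < R) (hM : 0 < M) {f : ℂ → ℂ}
    (hf : DifferentiableOn ℂ f (ball 0 R)) (h0 : ∀ z ∈ ball (0 : ℂ) R, f z ≠ 0)
    (hb : ∀ z ∈ ball (0 : ℂ) R, ‖f z‖ ≤ ‖f 0‖ * Real.exp M) :
    ∃ (c : ℂ) (e : ℂ → ℂ), ‖c‖ ≤ 10 * M / R ∧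
      ∀ z : ℂ, ‖z‖ ≤ R / 2 → f z = f 0 * exp (c * z + e z) ∧ ‖e z‖ ≤ 32 * M * (‖z‖ / R) ^ 2 := by
  obtain ⟨g, hg, hg0, hfg⟩ := exists_eq_mul_exp_of_ne_zero_ball hR hf h0
  have hmem : (0 : ℂ) ∈ ball (0 : ℂ) R := by simpa using hR
  have hre : Set.MapsTo g (ball 0 R) {z | z.re ≤ M} := by
    intro z hz
    have h1 := hb z hz
    rw [hfg z hz, norm_mul, norm_exp] at h1
    exact Real.exp_le_exp.1 (le_of_mul_le_mul_left h1 (norm_pos_iff.2 (h0 0 hmem)))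
  -- Borel–Carathéodory gives 2M|z| / (R - |z|), which is below 6M for |z| < 3R/4.
  have hgb : ∀ z ∈ ball (0 : ℂ) (3 / 4 * R), ‖g z‖ < 7 * M := by
    intro z hz
    have hz' : ‖z‖ < 3 / 4 * R := by simpa using hz
    have h1 := borelCaratheodory_zero hM hg hre hR (by simp; linarith) hg0
    refine h1.trans_lt ?_
    rw [div_lt_iff₀ (by linarith)]
    nlinarith [norm_nonneg z]
  have hsub : ball (0 : ℂ) (3 / 4 * R) ⊆ ball 0 R := ball_subset_ball (by linarith)
  have hR' : 0 < 3 / 4 * R := by linarith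
  have hg1 : DifferentiableOn ℂ (dslope g 0) (ball 0 (3 / 4 * R)) :=
    (differentiableOn_dslope (isOpen_ball.mem_nhds (by simpa using hR'))).2 (hg.mono hsub)
  have hds : ∀ z ∈ ball (0 : ℂ) (3 / 4 * R), ‖dslope g 0 z‖ ≤ 7 * M / (3 / 4 * R) := by
    intro z hz
    exact norm_dslope_le_div_of_mapsTo_ball (hg.mono hsub)
      (by intro w hw; simpa [hg0] using (hgb w hw).le) hz
  have hc : ‖dslope g 0 0‖ ≤ 7 * M / (3 / 4 * R) := hds 0 (by simpa using hR')
  refine ⟨dslope g 0 0, fun z => g z - dslope g 0 0 * z, hc.trans ?_, fun z hz => ⟨?_, ?_⟩⟩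
  · rw [div_le_div_iff₀ hR' hR]
    nlinarith [mul_pos hM hR]
  · rw [hfg z (by simp; linarith)]
    congr 2
    ring
  · have hz' : z ∈ ball (0 : ℂ) (3 / 4 * R) := by simp; linarith
    -- A second use of the Schwarz lemma, now on the difference quotient g(z)/z minus its value at
    -- 0, makes the remainder quadratic.
    have h1 := dist_le_div_mul_dist_of_mapsTo_ball (R₂ := 14 * M / (3 / 4 * R)) hg1 (by
      intro w hw
      rw [mem_closedBall, dist_eq_norm]
      refine (norm_sub_le _ _).trans ((add_le_add (hds w hw) hc).trans (le_of_eq ?_))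
      ring) hz'
    rw [dist_eq_norm, dist_eq_norm, sub_zero] at h1
    have h2 : g z - dslope g 0 0 * z = (dslope g 0 z - dslope g 0 0) * z := by
      have := sub_smul_dslope g 0 z
      rw [hg0, sub_zero, sub_zero, smul_eq_mul] at this
      rw [← this]
      ring
    change ‖g z - dslope g 0 0 * z‖ ≤ _
    rw [h2, norm_mul]
    refine (mul_le_mul_of_nonneg_right h1 (norm_nonneg z)).trans ?_
    have h3 : 14 * M / (3 / 4 * R) / (3 / 4 * R) * ‖z‖ * ‖z‖
        = 224 / 9 * (M * (‖z‖ / R) ^ 2) := by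
      field_simp
      ring
    rw [h3]
    have : 0 ≤ M * (‖z‖ / R) ^ 2 := by positivity
    linarith

/-! ### Counting zeroes of entire functions and dividing them out. -/

open Metric in
theorem finite_analyticOrderNatAt_ne_zero {F : ℂ → ℂ} (hF : Differentiable ℂ F)
    (hne : ∃ z, F z ≠ 0) (R : ℝ) :
    (closedBall (0 : ℂ) R ∩ Function.support (fun z => analyticOrderNatAt F z)).Finite := by
  by_contra hinf
  obtain ⟨x, -, hx⟩ := Set.Infinite.exists_accPt_of_subset_isCompact hinf
    (isCompact_closedBall (0 : ℂ) R) Set.inter_subset_left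
  obtain ⟨z, hz⟩ := hne
  apply hz
  have hfreq : ∃ᶠ w in nhdsWithin x {x}ᶜ, F w = 0 := by
    rw [accPt_iff_frequently_nhdsNE] at hx
    exact hx.mono fun w hw => apply_eq_zero_of_analyticOrderNatAt_ne_zero hw.2
  have hFa : AnalyticOnNhd ℂ F Set.univ := fun w _ => hF.analyticAt w
  have := hFa.eqOn_zero_of_preconnected_of_frequently_eq_zero isPreconnected_univ
    (Set.mem_univ x) hfreq
  simpa using this (Set.mem_univ z)

theorem analyticOrderAt_ne_top_of_entire {F : ℂ → ℂ} (hF : Differentiable ℂ F)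
    (hne : ∃ z, F z ≠ 0) (w : ℂ) : analyticOrderAt F w ≠ ⊤ := by
  intro h
  obtain ⟨z, hz⟩ := hne
  rw [AnalyticOnNhd.analyticOrderAt_eq_top_iff_eq_zero w (fun w => hF.analyticAt w)] at h
  exact hz (by rw [h]; rfl)

theorem exists_eq_sub_mul {F : ℂ → ℂ} (hF : Differentiable ℂ F) {a : ℂ} (ha : F a = 0) :
    ∃ E : ℂ → ℂ, Differentiable ℂ E ∧ ∀ z, F z = (z - a) * E z := by
  refine ⟨dslope F a, ?_, fun z => ?_⟩
  · rw [← differentiableOn_univ] at hF ⊢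
    exact (Complex.differentiableOn_dslope Filter.univ_mem).2 hF
  · have := sub_smul_dslope F a z
    rw [ha, sub_zero, smul_eq_mul] at this
    exact this.symm

theorem analyticOrderNatAt_sub_mul {E : ℂ → ℂ} (hE : Differentiable ℂ E)
    (hne : ∃ z, E z ≠ 0) (a z : ℂ) :
    analyticOrderNatAt (fun z => (z - a) * E z) z =
      (if z = a then 1 else 0) + analyticOrderNatAt E z := by
  have h1 : AnalyticAt ℂ (fun z : ℂ => z - a) z := by fun_prop
  have h2 : analyticOrderAt (fun z : ℂ => z - a) z = if z = a then 1 else 0 := by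
    split_ifs with h
    · subst h; exact analyticOrderAt_id_sub_const_self
    · exact analyticOrderAt_id_sub_const_of_ne h
  have h3 : analyticOrderNatAt (fun z : ℂ => z - a) z = if z = a then 1 else 0 := by
    rw [analyticOrderNatAt, h2]; split_ifs <;> rfl
  rw [← h3]
  exact analyticOrderNatAt_mul h1 (hE.analyticAt z) (by rw [h2]; split_ifs <;> simp)
    (analyticOrderAt_ne_top_of_entire hE hne z)

open Metric in
theorem zeroCount_sub_mul {E : ℂ → ℂ} (hE : Differentiable ℂ E)
    (hne : ∃ z, E z ≠ 0) (a : ℂ) (R : ℝ) :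
    zeroCount (fun z => (z - a) * E z) R = (if ‖a‖ ≤ R then 1 else 0)
      + zeroCount E R := by
  classical
  have hfin := finite_analyticOrderNatAt_ne_zero hE hne R
  unfold zeroCount
  simp only [analyticOrderNatAt_sub_mul hE hne]
  rw [finsum_mem_add_distrib' ?_ hfin]
  · congr 1
    split_ifs with h
    · rw [finsum_eq_single _ a fun b hb => by simp [hb]]
      simp [h]
    · refine finsum_mem_eq_zero_of_forall_eq_zero fun x hx => ?_
      rw [if_neg]
      rintro rfl
      exact h (by simpa using hx)
  · refine (Set.finite_singleton a).subset ?_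
    rintro x ⟨-, hx⟩
    by_contra hxa
    exact hx (by simp [show x ≠ a from hxa])

open Metric in
/-- The zeros of an entire function in a closed disk can be divided out. -/
theorem exists_multiset_prod_mul {R : ℝ} {F : ℂ → ℂ} (hF : Differentiable ℂ F)
    (hne : ∃ z, F z ≠ 0) :
    ∃ (s : Multiset ℂ) (E : ℂ → ℂ), Differentiable ℂ E ∧ (∀ a ∈ s, ‖a‖ ≤ R) ∧
      s.card ≤ zeroCount F R ∧ (∀ z, ‖z‖ ≤ R → E z ≠ 0) ∧
      ∀ z, F z = (s.map fun a => z - a).prod * E z := by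
  induction hn : zeroCount F R generalizing F with
  | zero =>
    by_cases h : ∃ a, ‖a‖ ≤ R ∧ F a = 0
    · obtain ⟨a, haR, ha⟩ := h
      obtain ⟨E, hE, hFE⟩ := exists_eq_sub_mul hF ha
      have hEne : ∃ z, E z ≠ 0 := hne.imp fun z hz h => hz (by rw [hFE, h, mul_zero])
      rw [show F = _ from funext hFE, zeroCount_sub_mul hE hEne, if_pos haR] at hn
      omega
    · push Not at h
      exact ⟨0, F, hF, by simp, by simp, h, by simp⟩
  | succ n ih =>
    by_cases h : ∃ a, ‖a‖ ≤ R ∧ F a = 0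
    · obtain ⟨a, haR, ha⟩ := h
      obtain ⟨E, hE, hFE⟩ := exists_eq_sub_mul hF ha
      have hEne : ∃ z, E z ≠ 0 := hne.imp fun z hz h => hz (by rw [hFE, h, mul_zero])
      rw [show F = _ from funext hFE, zeroCount_sub_mul hE hEne, if_pos haR] at hn
      obtain ⟨s, E', hE', hs, hc, h0, hEE⟩ := ih hE hEne (by omega)
      refine ⟨a ::ₘ s, E', hE', ?_, ?_, h0, ?_⟩
      · intro b hb
        rcases Multiset.mem_cons.1 hb with rfl | hb
        · exact haR
        · exact hs b hb
      · simpa using hc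
      · intro z
        rw [hFE, hEE, Multiset.map_cons, Multiset.prod_cons, mul_assoc]
    · push Not at h
      exact ⟨0, F, hF, by simp, by simp, h, by simp⟩

/-- An entire function is a power of `z` times a function not vanishing at the origin. -/
theorem exists_eq_pow_mul {F : ℂ → ℂ} (hF : Differentiable ℂ F) (hne : ∃ z, F z ≠ 0) :
    ∃ (m : ℕ) (E : ℂ → ℂ), Differentiable ℂ E ∧ E 0 ≠ 0 ∧ (∀ z, F z = z ^ m * E z) ∧
      ∀ R, 0 ≤ R → zeroCount E R ≤ zeroCount F R := by
  induction hn : analyticOrderNatAt F 0 generalizing F with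
  | zero =>
    by_cases h : F 0 = 0
    · obtain ⟨E, hE, hFE⟩ := exists_eq_sub_mul hF h
      have hEne : ∃ z, E z ≠ 0 := hne.imp fun z hz h => hz (by rw [hFE, h, mul_zero])
      rw [show F = _ from funext hFE, analyticOrderNatAt_sub_mul hE hEne, if_pos rfl] at hn
      omega
    · exact ⟨0, F, hF, h, by simp, fun _ _ => le_rfl⟩
  | succ n ih =>
    by_cases h : F 0 = 0
    · obtain ⟨E, hE, hFE⟩ := exists_eq_sub_mul hF h
      have hEne : ∃ z, E z ≠ 0 := hne.imp fun z hz h => hz (by rw [hFE, h, mul_zero])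
      rw [show F = _ from funext hFE, analyticOrderNatAt_sub_mul hE hEne, if_pos rfl] at hn
      obtain ⟨m, E', hE', h0, hEE, hz⟩ := ih hE hEne (by omega)
      refine ⟨m + 1, E', hE', h0, fun z => ?_, fun R hR => (hz R hR).trans ?_⟩
      · rw [hFE, hEE]; ring
      · rw [show F = _ from funext hFE, zeroCount_sub_mul hE hEne]
        omega
    · exact ⟨0, F, hF, h, by simp, fun _ _ => le_rfl⟩

/-! ### Reflection of zeroes in a circle and a Jensen-type inequality. -/

/-- The reflected factor `(ρ² - conj a * z) / ρ` for `‖a‖ ≤ ρ`, and `z - a` otherwise: an entire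
function whose modulus agrees with that of `z - a` on the circle of radius `ρ`. -/
noncomputable def reflectedFactor (ρ : ℝ) (a z : ℂ) : ℂ :=
  open scoped Classical in
  if ‖a‖ ≤ ρ then ((ρ : ℂ) ^ 2 - starRingEnd ℂ a * z) / ρ else z - a

theorem differentiable_reflectedFactor (ρ : ℝ) (a : ℂ) :
    Differentiable ℂ (reflectedFactor ρ a) := by
  unfold reflectedFactor
  split_ifs <;> fun_prop

theorem norm_reflectedFactor_of_norm_eq {ρ : ℝ} (hρ : 0 < ρ) (a : ℂ) {z : ℂ} (hz : ‖z‖ = ρ) :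
    ‖reflectedFactor ρ a z‖ = ‖z - a‖ := by
  unfold reflectedFactor
  split_ifs
  · have h : (ρ : ℂ) ^ 2 - starRingEnd ℂ a * z = z * starRingEnd ℂ (z - a) := by
      rw [map_sub, mul_sub, Complex.mul_conj, Complex.normSq_eq_norm_sq, hz]
      push_cast
      ring
    rw [h, norm_div, norm_mul, Complex.norm_conj, hz, Complex.norm_real, Real.norm_of_nonneg hρ.le]
    field_simp
  · rfl

theorem le_norm_reflectedFactor_zero {ρ : ℝ} (hρ : 0 < ρ) (a : ℂ) :
    ρ ≤ ‖reflectedFactor ρ a 0‖ := by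
  unfold reflectedFactor
  split_ifs with h
  · rw [mul_zero, sub_zero, norm_div, norm_pow, Complex.norm_real, Real.norm_of_nonneg hρ.le]
    exact le_of_eq (by field_simp)
  · rw [zero_sub, norm_neg]
    exact (not_le.1 h).le

theorem reflectedFactor_zero {ρ : ℝ} (hρ : 0 < ρ) {a : ℂ} (ha : ‖a‖ ≤ ρ) :
    reflectedFactor ρ a 0 = ρ := by
  have : (ρ : ℂ) ≠ 0 := by exact_mod_cast hρ.ne'
  rw [reflectedFactor, if_pos ha, mul_zero, sub_zero]
  field_simp

theorem reflectedFactor_ne_zero {ρ : ℝ} {a z : ℂ} (ha : ‖a‖ ≤ ρ)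
    (hz : ‖z‖ < ρ) : reflectedFactor ρ a z ≠ 0 := by
  have hρ : 0 < ρ := (norm_nonneg z).trans_lt hz
  have hρ' : (ρ : ℂ) ≠ 0 := by exact_mod_cast hρ.ne'
  rw [reflectedFactor, if_pos ha]
  refine div_ne_zero (fun h => ?_) hρ'
  have h1 : ‖(ρ : ℂ) ^ 2‖ = ‖starRingEnd ℂ a * z‖ := by rw [sub_eq_zero.1 h]
  rw [norm_mul, Complex.norm_conj, norm_pow, Complex.norm_real, Real.norm_of_nonneg hρ.le] at h1
  nlinarith [norm_nonneg a, norm_nonneg z]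

theorem norm_sub_le_norm_reflectedFactor {ρ : ℝ} (hρ : 0 < ρ) {a z : ℂ} (ha : ‖a‖ ≤ ρ)
    (hz : ‖z‖ ≤ ρ) : ‖z - a‖ ≤ ‖reflectedFactor ρ a z‖ := by
  rw [reflectedFactor, if_pos ha, norm_div, Complex.norm_real, Real.norm_of_nonneg hρ.le,
    le_div_iff₀ hρ]
  refine (sq_le_sq₀ (by positivity) (norm_nonneg _)).1 ?_
  have ha2 : ‖a‖ ^ 2 ≤ ρ ^ 2 := by gcongr
  have hz2 : ‖z‖ ^ 2 ≤ ρ ^ 2 := by gcongr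
  have key := mul_nonneg (sub_nonneg.2 ha2) (sub_nonneg.2 hz2)
  rw [Complex.sq_norm, Complex.sq_norm, Complex.normSq_apply, Complex.normSq_apply] at key
  rw [mul_pow, Complex.sq_norm, Complex.sq_norm, Complex.normSq_apply, Complex.normSq_apply]
  have e1 : ((ρ : ℂ) ^ 2).re = ρ ^ 2 := by norm_cast
  have e2 : ((ρ : ℂ) ^ 2).im = 0 := by norm_cast
  simp only [Complex.sub_re, Complex.sub_im, Complex.mul_re, Complex.mul_im, Complex.conj_re,
    Complex.conj_im, e1, e2]
  linarith

theorem norm_prod_map_le_norm_prod_map {ι : Type*} {s : Multiset ι} {f g : ι → ℂ}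
    (h : ∀ a ∈ s, ‖f a‖ ≤ ‖g a‖) : ‖(s.map f).prod‖ ≤ ‖(s.map g).prod‖ := by
  induction s using Multiset.induction_on with
  | empty => simp
  | cons a s ih =>
    rw [Multiset.map_cons, Multiset.map_cons, Multiset.prod_cons, Multiset.prod_cons, norm_mul,
      norm_mul]
    exact mul_le_mul (h a (Multiset.mem_cons_self a s))
      (ih fun b hb => h b (Multiset.mem_cons_of_mem hb)) (norm_nonneg _) (norm_nonneg _)

theorem differentiable_prod_reflectedFactor (ρ : ℝ) (s : Multiset ℂ) :
    Differentiable ℂ fun z => (s.map fun a => reflectedFactor ρ a z).prod := by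
  induction s using Multiset.induction_on with
  | empty => simp
  | cons a s ih =>
    simp only [Multiset.map_cons, Multiset.prod_cons]
    exact (differentiable_reflectedFactor ρ a).mul ih

-- Reflection preserves moduli on the circle, so the maximum principle carries the boundary bound
-- inside.
open Metric in
theorem norm_mul_prod_reflectedFactor_le {ρ C : ℝ} (hρ : 0 < ρ) {E : ℂ → ℂ} {s : Multiset ℂ}
    (hE : Differentiable ℂ E)
    (hC : ∀ z, ‖z‖ = ρ → ‖(s.map fun a => z - a).prod * E z‖ ≤ C) {z : ℂ} (hz : ‖z‖ ≤ ρ) :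
    ‖(s.map fun a => reflectedFactor ρ a z).prod * E z‖ ≤ C := by
  have hd := (differentiable_prod_reflectedFactor ρ s).mul hE
  refine Complex.norm_le_of_forall_mem_frontier_norm_le
    (f := (fun z => (s.map fun a => reflectedFactor ρ a z).prod) * E) (U := ball (0 : ℂ) ρ)
    isBounded_ball hd.diffContOnCl ?_ ?_
  · intro w hw
    rw [frontier_ball _ hρ.ne'] at hw
    have hw' : ‖w‖ = ρ := by simpa using hw
    refine le_trans ?_ (hC w hw')
    simp only [Pi.mul_apply]
    rw [norm_mul, norm_mul]
    exact mul_le_mul_of_nonneg_right (norm_prod_map_le_norm_prod_map fun a _ =>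
      (norm_reflectedFactor_of_norm_eq hρ a hw').le) (norm_nonneg _)
  · rw [closure_ball _ hρ.ne']
    simpa using hz

/-- A form of Jensen's inequality: each factor has modulus at least ρ at the origin, even when its
zero lies outside the circle. Thus ρ may be far smaller than the radius of the disk containing `s`.
-/
theorem pow_card_mul_norm_le {ρ C : ℝ} (hρ : 0 < ρ) {E : ℂ → ℂ} {s : Multiset ℂ}
    (hE : Differentiable ℂ E)
    (hC : ∀ z, ‖z‖ = ρ → ‖(s.map fun a => z - a).prod * E z‖ ≤ C) :
    ρ ^ s.card * ‖E 0‖ ≤ C := by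
  refine le_trans ?_ (norm_mul_prod_reflectedFactor_le hρ hE hC (z := 0) (by simpa using hρ.le))
  rw [norm_mul]
  refine mul_le_mul_of_nonneg_right ?_ (norm_nonneg _)
  have := norm_prod_map_le_norm_prod_map (s := s) (f := fun _ => (ρ : ℂ))
    (g := fun a => reflectedFactor ρ a 0) fun a _ => by
      rw [Complex.norm_real, Real.norm_of_nonneg hρ.le]
      exact le_norm_reflectedFactor_zero hρ a
  refine le_trans (le_of_eq ?_) this
  simp [abs_of_pos hρ]

/-! ### Few zeroes imply slow growth of F(z) exp(-cz). -/

open Metric in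
/-- An entire function of exponential growth with few zeros in a disk is nearly an exponential
in a smaller disk. -/
theorem exists_norm_mul_exp_neg_le {F : ℂ → ℂ} (hF : Differentiable ℂ F) (h0 : F 0 ≠ 0)
    {A K R η M : ℝ} (hb : ∀ z, 1 ≤ ‖z‖ → ‖F z‖ ≤ A * Real.exp (K * ‖z‖)) (hA : 0 < A)
    (hη : 0 < η) (hη1 : η ≤ 1) (hηR : 1 ≤ η * R)
    (hM : M = K * R + (Real.log A - Real.log ‖F 0‖)) (hM0 : 0 < M) :
    ∃ c : ℂ, ‖c‖ ≤ 10 * M / R ∧ ∀ z : ℂ, ‖z‖ ≤ R / 2 → ‖F z * Complex.exp (-(c * z))‖ ≤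
      A * Real.exp (K * (η * R)) * (1 / η) ^ zeroCount F R *
        Real.exp (32 * M * (‖z‖ / R) ^ 2) := by
  have hR1 : 1 ≤ R := by nlinarith
  have hR : 0 < R := by linarith
  have hF0 : 0 < ‖F 0‖ := norm_pos_iff.2 h0
  obtain ⟨s, E, hE, hs, hcard, hE0, hFE⟩ := exists_multiset_prod_mul (R := R) hF ⟨0, h0⟩
  have hC : ∀ ρ, 1 ≤ ρ → ∀ z : ℂ, ‖z‖ = ρ →
      ‖(s.map fun a => z - a).prod * E z‖ ≤ A * Real.exp (K * ρ) := by
    intro ρ hρ z hz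
    rw [← hFE, ← hz]
    exact hb z (by rw [hz]; exact hρ)
  set f : ℂ → ℂ := fun z => (s.map fun a => reflectedFactor R a z).prod * E z with hf
  have hfd : Differentiable ℂ f := (differentiable_prod_reflectedFactor R s).mul hE
  have hfn : ∀ z ∈ ball (0 : ℂ) R, f z ≠ 0 := by
    intro z hz
    have hz' : ‖z‖ < R := by simpa using hz
    refine mul_ne_zero (Multiset.prod_ne_zero ?_) (hE0 z hz'.le)
    intro h
    obtain ⟨a, ha, ha0⟩ := Multiset.mem_map.1 h
    exact reflectedFactor_ne_zero (hs a ha) hz' ha0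
  have hle : ∀ z : ℂ, ‖z‖ ≤ R → ‖F z‖ ≤ ‖f z‖ := by
    intro z hz
    rw [hFE, hf, norm_mul, norm_mul]
    exact mul_le_mul_of_nonneg_right (norm_prod_map_le_norm_prod_map fun a ha =>
      norm_sub_le_norm_reflectedFactor hR (hs a ha) hz) (norm_nonneg _)
  have hexpM : ‖F 0‖ * Real.exp M = A * Real.exp (K * R) := by
    rw [hM, Real.exp_add, Real.exp_sub, Real.exp_log hA, Real.exp_log hF0]
    field_simp
  have hfb : ∀ z ∈ ball (0 : ℂ) R, ‖f z‖ ≤ ‖f 0‖ * Real.exp M := by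
    intro z hz
    have hz' : ‖z‖ < R := by simpa using hz
    refine (norm_mul_prod_reflectedFactor_le hR hE (hC R hR1) hz'.le).trans ?_
    rw [← hexpM]
    exact mul_le_mul_of_nonneg_right (hle 0 (by simpa using hR.le)) (Real.exp_pos _).le
  obtain ⟨c, e, hc, hce⟩ := exists_eq_mul_exp_linear hR hM0 hfd.differentiableOn hfn hfb
  -- Jensen's inequality on the small circle of radius ηR replaces exp(KR) by exp(KηR), at the price
  -- of a factor 1/η per zero.
  have hf0 : ‖f 0‖ ≤ A * Real.exp (K * (η * R)) * (1 / η) ^ zeroCount F R := by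
    have h1 : ‖f 0‖ = R ^ s.card * ‖E 0‖ := by
      have : (s.map fun a => reflectedFactor R a 0) = s.map fun _ => (R : ℂ) :=
        Multiset.map_congr rfl fun a ha => reflectedFactor_zero hR (hs a ha)
      simp [hf, this, abs_of_pos hR]
    have h2 := pow_card_mul_norm_le (by linarith) hE (hC (η * R) hηR)
    have h3 : R ^ s.card = (η * R) ^ s.card * (1 / η) ^ s.card := by
      rw [← mul_pow]
      congr 1
      field_simp
    rw [h1, h3, mul_right_comm]
    have h4 : (1 / η) ^ s.card ≤ (1 / η) ^ zeroCount F R :=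
      pow_le_pow_right₀ (by rw [le_div_iff₀ hη]; linarith) hcard
    exact mul_le_mul h2 h4 (by positivity) (by positivity)
  refine ⟨c, hc, fun z hz => ?_⟩
  obtain ⟨hz1, hz2⟩ := hce z hz
  calc ‖F z * Complex.exp (-(c * z))‖ ≤ ‖f z * Complex.exp (-(c * z))‖ := by
        rw [norm_mul, norm_mul]
        exact mul_le_mul_of_nonneg_right (hle z (by linarith)) (norm_nonneg _)
    _ = ‖f 0‖ * ‖Complex.exp (e z)‖ := by
        rw [hz1, mul_assoc, ← Complex.exp_add, ← norm_mul]
        congr 3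
        ring
    _ ≤ _ := by
        refine mul_le_mul hf0 ?_ (norm_nonneg _) (by positivity)
        exact (Complex.norm_exp_le_exp_norm _).trans (Real.exp_le_exp.2 hz2)

-- Here N is about tR/A, so that |z| ≤ AN means |z| ≤ tR. The quadratic error is of order KRt²,
-- linear in t once R is expressed through N.
open Filter in
theorem exists_frequently_norm_mul_exp_neg_le {K A ε : ℝ} (hK : 0 < K) (hA : 1 ≤ A)
    (hε : 0 < ε) : ∃ χ : ℝ, 0 < χ ∧ ∀ F : ℂ → ℂ, Differentiable ℂ F → (∃ z, F z ≠ 0) →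
      (∃ B : ℝ, ∀ z, ‖F z‖ ≤ B * Real.exp (K * ‖z‖)) →
      (∃ᶠ R : ℝ in atTop, (zeroCount F R : ℝ) / R < χ) →
      ∃ᶠ N : ℕ in atTop, ∃ c : ℂ, ‖c‖ ≤ 20 * K ∧
        ∀ z : ℂ, ‖z‖ ≤ A * N → ‖F z * Complex.exp (-(c * z))‖ ≤ Real.exp (ε * N) := by
  -- With R ≤ (2A/t)N, three errors are each kept below εN/8: t controls the quadratic term, then η
  -- the growth on the small circle, then χ the cost χR log(1/η) of the zeroes.
  obtain ⟨t, ht0, ht1, ht2⟩ : ∃ t : ℝ, 0 < t ∧ t ≤ 1 / 2 ∧ 64 * A * K * t ≤ ε / 8 := by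
    refine ⟨min (1 / 2) (ε / (512 * A * K)), by positivity, min_le_left _ _, ?_⟩
    have : min (1 / 2) (ε / (512 * A * K)) ≤ ε / (512 * A * K) := min_le_right _ _
    rw [le_div_iff₀ (by positivity)] at this
    linarith
  obtain ⟨η, hη0, hη1, hη2⟩ : ∃ η : ℝ, 0 < η ∧ η ≤ 1 / 2 ∧ K * η * (2 * A / t) ≤ ε / 8 := by
    refine ⟨min (1 / 2) (ε / 8 / (K * (2 * A / t))), by positivity, min_le_left _ _, ?_⟩
    have : min (1 / 2) (ε / 8 / (K * (2 * A / t))) ≤ ε / 8 / (K * (2 * A / t)) := min_le_right _ _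
    rw [le_div_iff₀ (by positivity)] at this
    linarith
  have hL : 0 < Real.log (1 / η) := by
    refine Real.log_pos ?_
    rw [lt_div_iff₀ hη0]
    linarith
  set L := Real.log (1 / η) with hLdef
  refine ⟨ε / 8 / (L * (2 * A / t)), by positivity, ?_⟩
  set χ := ε / 8 / (L * (2 * A / t)) with hχ
  have hχL : χ * L * (2 * A / t) = ε / 8 := by rw [hχ]; field_simp
  have hχ0 : 0 < χ := by positivity
  clear_value χ L
  rintro F hF hne ⟨B, hB⟩ hfreq
  obtain ⟨m, F₁, hF₁, hF₁0, hFF, hcount⟩ := exists_eq_pow_mul hF hne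
  have hF₁n : 0 < ‖F₁ 0‖ := norm_pos_iff.2 hF₁0
  set B' := max B 1 with hB'
  have hB'1 : 0 < B' := lt_of_lt_of_le one_pos (le_max_right _ _)
  have hb : ∀ z, 1 ≤ ‖z‖ → ‖F₁ z‖ ≤ B' * Real.exp (K * ‖z‖) := by
    intro z hz
    have h1 := hB z
    rw [hFF, norm_mul, norm_pow] at h1
    calc ‖F₁ z‖ ≤ ‖z‖ ^ m * ‖F₁ z‖ := le_mul_of_one_le_left (norm_nonneg _) (one_le_pow₀ hz)
      _ ≤ _ := h1
      _ ≤ _ := by gcongr; exact le_max_left _ _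
  set C₀ := Real.log B' - Real.log ‖F₁ 0‖ with hC₀
  have hτ : Tendsto (fun R : ℝ => ⌊t * R / A⌋₊) atTop atTop := by
    refine tendsto_nat_floor_atTop.comp ?_
    exact (tendsto_id.const_mul_atTop ht0).atTop_div_const (by linarith)
  -- The terms depending on F (the zero at the origin, the growth constant, the value of the
  -- cofactor at 0) are o(N); absorbing them for large N keeps χ independent of F.
  have hlog : ∀ᶠ N : ℕ in atTop,
      m * Real.log (A * N) + Real.log B' + 32 * |C₀| ≤ ε / 2 * N := by
    have h1 : (fun x : ℝ => m * Real.log x + (Real.log B' + 32 * |C₀|)) =o[atTop]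
        (fun x : ℝ => x) :=
      (Real.isLittleO_log_id_atTop.const_mul_left _).add
        (Asymptotics.isLittleO_const_left.2 (Or.inr tendsto_norm_atTop_atTop))
    have h2 := h1.bound (show 0 < ε / 2 / A by positivity)
    have h3 : Tendsto (fun N : ℕ => A * (N : ℝ)) atTop atTop :=
      tendsto_natCast_atTop_atTop.const_mul_atTop (by linarith)
    filter_upwards [h3.eventually h2] with N hN
    rw [Real.norm_of_nonneg (show 0 ≤ A * (N : ℝ) by positivity)] at hN
    have h4 := (le_abs_self _).trans hN
    have h5 : ε / 2 / A * (A * N) = ε / 2 * N := by field_simp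
    linarith
  refine hτ.frequently ((hfreq.and_eventually ((hτ.eventually hlog).and
    ((hτ.eventually_ge_atTop 1).and ((eventually_ge_atTop (1 / η)).and
    (eventually_gt_atTop (|C₀| / K)))))).mono ?_)
  rintro R ⟨hRz, hRlog, hRN, hRη, hRC⟩
  set N := ⌊t * R / A⌋₊ with hN
  have hR0 : 0 < R := lt_of_lt_of_le (by positivity) hRη
  have hN1 : (1 : ℝ) ≤ N := by exact_mod_cast hRN
  have hAN : A * N ≤ t * R := by
    have := Nat.floor_le (show 0 ≤ t * R / A by positivity)
    rw [le_div_iff₀ (by linarith)] at this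
    linarith
  have hRle : R ≤ 2 * A / t * N := by
    have h1 := Nat.lt_floor_add_one (t * R / A)
    rw [← hN, div_lt_iff₀ (by linarith)] at h1
    rw [div_mul_eq_mul_div, le_div_iff₀ ht0]
    have h2 : A * 1 ≤ A * N := by gcongr
    linarith
  clear_value N
  rw [div_lt_iff₀ hK] at hRC
  have hM0 : 0 < K * R + C₀ := by linarith [neg_abs_le C₀]
  have hηR : 1 ≤ η * R := by
    rw [div_le_iff₀ hη0] at hRη
    linarith
  obtain ⟨c, hc, hcz⟩ := exists_norm_mul_exp_neg_le hF₁ hF₁0 hb hB'1 hη0 (by linarith) hηR rfl hM0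
  refine ⟨c, hc.trans ?_, fun z hz => ?_⟩
  · rw [div_le_iff₀ hR0]
    linarith [le_abs_self C₀]
  have hzt : ‖z‖ ≤ t * R := hz.trans hAN
  have hzc : (zeroCount F₁ R : ℝ) ≤ χ * R := by
    rw [div_lt_iff₀ hR0] at hRz
    have : (zeroCount F₁ R : ℝ) ≤ zeroCount F R := by exact_mod_cast hcount R hR0.le
    linarith
  have htR : t * R ≤ 1 / 2 * R := by gcongr
  have h1 := hcz z (by linarith)
  have hzR : (‖z‖ / R) ^ 2 ≤ t ^ 2 := by
    gcongr
    rwa [div_le_iff₀ hR0]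
  have hpow : (1 / η) ^ zeroCount F₁ R = Real.exp (zeroCount F₁ R * L) := by
    rw [mul_comm, Real.exp_mul, hLdef, Real.exp_log (by positivity), Real.rpow_natCast]
  have hAN0 : 0 < A * N := by positivity
  have hzm : ‖z‖ ^ m ≤ Real.exp (m * Real.log (A * N)) := by
    rw [mul_comm, Real.exp_mul, Real.exp_log hAN0, Real.rpow_natCast]
    gcongr
  rw [hFF, mul_assoc, norm_mul, norm_pow]
  calc ‖z‖ ^ m * ‖F₁ z * Complex.exp (-(c * z))‖
      ≤ Real.exp (m * Real.log (A * N)) * (B' * Real.exp (K * (η * R)) *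
        (1 / η) ^ zeroCount F₁ R * Real.exp (32 * (K * R + C₀) * (‖z‖ / R) ^ 2)) :=
        mul_le_mul hzm h1 (norm_nonneg _) (Real.exp_pos _).le
    _ = Real.exp (m * Real.log (A * N) + Real.log B' + K * (η * R) + zeroCount F₁ R * L +
        32 * (K * R + C₀) * (‖z‖ / R) ^ 2) := by
        rw [hpow, Real.exp_add, Real.exp_add, Real.exp_add, Real.exp_add, Real.exp_log hB'1]
        ring
    _ ≤ Real.exp (ε * N) := by
        refine Real.exp_le_exp.2 ?_
        have e1 : K * (η * R) ≤ ε / 8 * N := by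
          calc K * (η * R) = K * η * R := by ring
            _ ≤ K * η * (2 * A / t * N) := by gcongr
            _ = K * η * (2 * A / t) * N := by ring
            _ ≤ _ := by gcongr
        have e2 : zeroCount F₁ R * L ≤ ε / 8 * N := by
          calc zeroCount F₁ R * L ≤ χ * R * L := by gcongr
            _ ≤ χ * (2 * A / t * N) * L := by gcongr
            _ = χ * L * (2 * A / t) * N := by ring
            _ = _ := by rw [hχL]
        have e3 : 32 * (K * R + C₀) * (‖z‖ / R) ^ 2 ≤ ε / 8 * N + 32 * |C₀| := by
          have g1 : 32 * (K * R + C₀) * (‖z‖ / R) ^ 2 ≤ 32 * (K * R + C₀) * t ^ 2 := by gcongr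
          have g2 : 32 * (K * R) * t ^ 2 ≤ ε / 8 * N := by
            calc 32 * (K * R) * t ^ 2 ≤ 32 * (K * (2 * A / t * N)) * t ^ 2 := by gcongr
              _ = 64 * A * K * t * N := by field_simp; ring
              _ ≤ _ := by gcongr
          have g3 : C₀ * t ^ 2 ≤ |C₀| := by
            calc C₀ * t ^ 2 ≤ |C₀| * t ^ 2 := by gcongr; exact le_abs_self _
              _ ≤ |C₀| * 1 := by gcongr; exact pow_le_one₀ ht0.le (by linarith)
              _ = _ := mul_one _
          linarith
        have e4 : 0 ≤ ε * N := by positivity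
        linarith

/-! ### Taylor coefficients as values of a polynomial at integers. -/

open Filter in
theorem eq_iteratedDeriv_of_hasSum {ω : ℕ → ℂ} {F : ℂ → ℂ}
    (h : ∀ z : ℂ, HasSum (fun n : ℕ => ω n * (z ^ n / (n.factorial : ℂ))) (F z)) (n : ℕ) :
    ω n = iteratedDeriv n F 0 := by
  have h1 : HasFPowerSeriesAt F
      (FormalMultilinearSeries.ofScalars ℂ fun n => ω n / n.factorial) 0 := by
    rw [hasFPowerSeriesAt_iff]
    refine Eventually.of_forall fun z => ?_
    simp only [FormalMultilinearSeries.coeff_ofScalars, zero_add, smul_eq_mul]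
    have h1 : (fun n : ℕ => z ^ n * (ω n / n.factorial)) =
        fun n : ℕ => ω n * (z ^ n / (n.factorial : ℂ)) := by
      funext n
      ring
    rw [h1]
    exact h z
  have h2 := h1.eq_formalMultilinearSeries h1.analyticAt.hasFPowerSeriesAt
  have h3 := congrArg (fun p => FormalMultilinearSeries.coeff p n) h2
  simp only [FormalMultilinearSeries.coeff_ofScalars] at h3
  have : (n.factorial : ℂ) ≠ 0 := by exact_mod_cast n.factorial_ne_zero
  field_simp at h3
  exact h3

theorem iteratedDeriv_eq_sum_mul_exp_neg {F : ℂ → ℂ} (hF : Differentiable ℂ F) (c : ℂ) (n : ℕ) :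
    iteratedDeriv n F 0 = ∑ k ∈ Finset.range (n + 1), n.choose k *
      iteratedDeriv k (fun z => F z * Complex.exp (-(c * z))) 0 * c ^ (n - k) := by
  have h1 : F = (fun z => F z * Complex.exp (-(c * z))) * fun z => Complex.exp (c * z) := by
    funext z
    simp [mul_assoc, ← Complex.exp_add]
  have hG : Differentiable ℂ fun z => F z * Complex.exp (-(c * z)) := by fun_prop
  have hE : Differentiable ℂ fun z => Complex.exp (c * z) := by fun_prop
  conv_lhs => rw [h1]
  rw [iteratedDeriv_mul hG.contDiff.contDiffAt hE.contDiff.contDiffAt]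
  refine Finset.sum_congr rfl fun k _ => ?_
  rw [iteratedDeriv_cexp_const_mul]
  simp

theorem norm_iteratedDeriv_zero_le {G : ℂ → ℂ} (hG : Differentiable ℂ G) {ρ B : ℝ} (hρ : 0 < ρ)
    (hB : ∀ z, ‖z‖ ≤ ρ → ‖G z‖ ≤ B) (k : ℕ) :
    ‖iteratedDeriv k G 0‖ ≤ k.factorial * B / ρ ^ k :=
  Complex.norm_iteratedDeriv_le_of_forall_mem_sphere_norm_le k hρ hG.diffContOnCl
    fun z hz => hB z (by simpa using (mem_sphere_zero_iff_norm.1 hz).le)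

/-- Cauchy's estimates with k! ≤ N^k turn the Leibniz sum into a binomial expansion. This bound does
not divide by c, so it can exclude small |c|. -/
theorem norm_iteratedDeriv_zero_le_pow {F : ℂ → ℂ} (hF : Differentiable ℂ F) {c : ℂ} {ρ B : ℝ}
    (hρ : 0 < ρ) (hB : ∀ z, ‖z‖ ≤ ρ → ‖F z * Complex.exp (-(c * z))‖ ≤ B) {n N : ℕ} (hn : n ≤ N) :
    ‖iteratedDeriv n F 0‖ ≤ B * (N / ρ + ‖c‖) ^ n := by
  have hB0 : 0 ≤ B := (norm_nonneg _).trans (hB 0 (by simpa using hρ.le))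
  rw [iteratedDeriv_eq_sum_mul_exp_neg hF c, add_pow, Finset.mul_sum]
  refine norm_sum_le_of_le _ fun k hk => ?_
  have hkn : k ≤ n := Nat.lt_succ_iff.1 (Finset.mem_range.1 hk)
  have h1 := norm_iteratedDeriv_zero_le (G := fun z => F z * Complex.exp (-(c * z)))
    (by fun_prop) hρ hB k
  have h2 : (k.factorial : ℝ) ≤ (N : ℝ) ^ k := by
    calc (k.factorial : ℝ) ≤ (k : ℝ) ^ k := by exact_mod_cast k.factorial_le_pow
      _ ≤ _ := by gcongr; exact hkn.trans hn
  rw [norm_mul, norm_mul, norm_pow, Complex.norm_natCast]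
  calc (n.choose k : ℝ) * ‖iteratedDeriv k (fun z => F z * Complex.exp (-(c * z))) 0‖ *
        ‖c‖ ^ (n - k) ≤ n.choose k * (N ^ k * B / ρ ^ k) * ‖c‖ ^ (n - k) := by
        gcongr
        exact h1.trans (by gcongr)
    _ = _ := by rw [div_pow]; ring

open Polynomial in
theorem norm_eval_descPochhammer_le {k N : ℕ} (hk : k ≤ N) (z : ℂ) :
    ‖(descPochhammer ℂ k).eval z‖ ≤ (‖z‖ + N) ^ k := by
  induction k with
  | zero => simp
  | succ k ih =>
    rw [descPochhammer_succ_eval, norm_mul, pow_succ]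
    refine mul_le_mul (ih (by omega)) ((norm_sub_le _ _).trans ?_) (norm_nonneg _) (by positivity)
    rw [Complex.norm_natCast]
    gcongr
    omega

open Polynomial in
/-- The derivatives at the origin of a function close to `exp (c z)` are, up to the factor `c ^ n`,
the values at the integers of a polynomial of moderate growth. -/
theorem exists_polynomial_eval_eq {F : ℂ → ℂ} (hF : Differentiable ℂ F) {c : ℂ} (hc : 1 / 2 ≤ ‖c‖)
    {N : ℕ} (hN : 1 ≤ N) {B : ℝ}
    (hB : ∀ z, ‖z‖ ≤ 32 * N → ‖F z * Complex.exp (-(c * z))‖ ≤ B) :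
    ∃ p : ℂ[X], (∀ n ≤ N, iteratedDeriv n F 0 = c ^ n * p.eval (n : ℂ)) ∧
      ∀ z, ‖z‖ ≤ 7 * N → ‖p.eval z‖ ≤ 2 * B := by
  have hN0 : (0 : ℝ) < N := by exact_mod_cast hN
  have hc0 : c ≠ 0 := norm_pos_iff.1 (by linarith)
  have hB0 : 0 ≤ B := (norm_nonneg _).trans (hB 0 (by simp))
  set g : ℕ → ℂ := fun k => iteratedDeriv k (fun z => F z * Complex.exp (-(c * z))) 0 with hg
  have hgb : ∀ k, ‖g k‖ ≤ k.factorial * B / (32 * N) ^ k := fun k =>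
    norm_iteratedDeriv_zero_le (G := fun z => F z * Complex.exp (-(c * z)))
      (by fun_prop) (by positivity) hB k
  -- Newton's form of the Leibniz sum: binom(n, k) is a polynomial in n that vanishes for k > n, so
  -- one sum up to N serves every n ≤ N.
  refine ⟨∑ k ∈ Finset.range (N + 1), C (g k / (c ^ k * k.factorial)) * descPochhammer ℂ k,
    fun n hn => ?_, fun z hz => ?_⟩
  · rw [iteratedDeriv_eq_sum_mul_exp_neg hF c, eval_finsetSum, Finset.mul_sum]
    rw [← Finset.sum_subset (Finset.range_mono (show n + 1 ≤ N + 1 by omega))]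
    · refine Finset.sum_congr rfl fun k hk => ?_
      have hkn : k ≤ n := Nat.lt_succ_iff.1 (Finset.mem_range.1 hk)
      rw [eval_mul, eval_C, descPochhammer_eval_eq_descFactorial,
        Nat.descFactorial_eq_factorial_mul_choose]
      have : (k.factorial : ℂ) ≠ 0 := by exact_mod_cast k.factorial_ne_zero
      have h2 : c ^ n = c ^ (n - k) * c ^ k := by rw [← pow_add]; congr 1; omega
      push_cast
      rw [h2]
      field_simp
      rfl
    · intro k _ hk
      rw [eval_mul, descPochhammer_eval_eq_descFactorial, Nat.descFactorial_of_lt]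
      · simp
      · simp at hk; omega
  · rw [eval_finsetSum]
    -- The ratio is (7N + N) / (32N · 1/2) = 1/2, and the geometric series sums to at most 2.
    have hterm : ∀ k ∈ Finset.range (N + 1),
        ‖(C (g k / (c ^ k * k.factorial)) * descPochhammer ℂ k).eval z‖ ≤ B * (1 / 2) ^ k := by
      intro k hk
      have hkN : k ≤ N := Nat.lt_succ_iff.1 (Finset.mem_range.1 hk)
      have hf : (0 : ℝ) < k.factorial := by exact_mod_cast k.factorial_pos
      rw [eval_mul, eval_C, norm_mul, norm_div, norm_mul, norm_pow, Complex.norm_natCast]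
      calc ‖g k‖ / (‖c‖ ^ k * k.factorial) * ‖(descPochhammer ℂ k).eval z‖
          ≤ (k.factorial * B / (32 * N) ^ k) / ((1 / 2) ^ k * k.factorial) *
            (7 * N + N) ^ k := by
            gcongr
            · exact hgb k
            · exact (norm_eval_descPochhammer_le hkN z).trans (by gcongr)
        _ = B * (1 / 2) ^ k := by
            have hpow : (7 * N + N : ℝ) ^ k = (1 / 2) ^ k * (1 / 2) ^ k * (32 * N) ^ k := by
              rw [← mul_pow, ← mul_pow]
              congr 1
              ring
            rw [hpow]
            field_simp
    refine (norm_sum_le_of_le _ hterm).trans ?_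
    rw [← Finset.mul_sum, mul_comm]
    refine mul_le_mul_of_nonneg_right ?_ hB0
    have := sum_geometric_two_le (N + 1)
    exact this

/-! ### Polynomials small at many integers. -/

open Polynomial Metric in
/-- A polynomial with many zeros in a small disk is small there. -/
theorem norm_eval_le_of_zeros {p : ℂ[X]} {T : Finset ℕ} {N : ℕ} (hN : 1 ≤ N) (hT : ∀ n ∈ T, n ≤ N)
    (h0 : ∀ n ∈ T, p.eval (n : ℂ) = 0) {B : ℝ} (hB : ∀ z, ‖z‖ ≤ 7 * N → ‖p.eval z‖ ≤ B)
    {z : ℂ} (hz : ‖z‖ ≤ N) : ‖p.eval z‖ ≤ B * (1 / 3) ^ T.card := by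
  have hN0 : (0 : ℝ) < N := by exact_mod_cast hN
  obtain ⟨q, hq⟩ : (∏ n ∈ T, (X - C (n : ℂ))) ∣ p := by
    refine Finset.prod_dvd_of_coprime (fun a _ b _ hab => ?_) fun n hn =>
      dvd_iff_isRoot.2 (h0 n hn)
    exact pairwise_coprime_X_sub_C (Nat.cast_injective (R := ℂ)) hab
  have hprod : ∀ w : ℂ, p.eval w = (∏ n ∈ T, (w - n)) * q.eval w := by
    intro w
    rw [hq, eval_mul, eval_prod]
    simp
  -- On |w| = 7N each factor is at least 6N, while on |z| ≤ N it is at most 2N: every zero gains a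
  -- factor 1/3.
  have hqb : ∀ w : ℂ, ‖w‖ ≤ 7 * N → ‖q.eval w‖ ≤ B / (6 * N) ^ T.card := by
    intro w hw
    refine Complex.norm_le_of_forall_mem_frontier_norm_le (f := fun w => q.eval w)
      (U := ball (0 : ℂ) (7 * N)) isBounded_ball q.differentiable.diffContOnCl ?_ ?_
    · intro u hu
      rw [frontier_ball _ (by positivity)] at hu
      have hu' : ‖u‖ = 7 * N := by simpa using hu
      rw [le_div_iff₀ (by positivity)]
      have h1 := hB u hu'.le
      rw [hprod, norm_mul, norm_prod] at h1
      refine le_trans ?_ h1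
      rw [mul_comm, ← Finset.prod_const]
      refine mul_le_mul_of_nonneg_right (Finset.prod_le_prod (fun _ _ => by positivity)
        fun n hn => ?_) (norm_nonneg _)
      have h2 := norm_sub_norm_le u n
      rw [hu', Complex.norm_natCast] at h2
      have h3 : (n : ℝ) ≤ N := by exact_mod_cast hT n hn
      linarith
    · rw [closure_ball _ (by positivity)]
      simpa using hw
  rw [hprod, norm_mul, norm_prod]
  calc (∏ n ∈ T, ‖z - n‖) * ‖q.eval z‖ ≤ (∏ n ∈ T, (2 * N : ℝ)) * (B / (6 * N) ^ T.card) := by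
        refine mul_le_mul (Finset.prod_le_prod (fun _ _ => norm_nonneg _) fun n hn => ?_)
          (hqb z (by linarith)) (norm_nonneg _) (by positivity)
        refine (norm_sub_le _ _).trans ?_
        rw [Complex.norm_natCast]
        have h3 : (n : ℝ) ≤ N := by exact_mod_cast hT n hn
        linarith
    _ = B * (2 * N / (6 * N)) ^ T.card := by
        rw [Finset.prod_const, div_pow]
        ring
    _ = _ := by
        congr 2
        field_simp
        norm_num

theorem factorial_mul_factorial_eq_prod_abs_sub {m i : ℕ} (hi : i ≤ m) :
    ((i.factorial * (m - i).factorial : ℕ) : ℝ) =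
      ∏ j ∈ (Finset.range (m + 1)).erase i, |(i : ℝ) - j| := by
  have h1 : (Finset.range (m + 1)).erase i = Finset.range i ∪ Finset.Ioc i m := by
    ext j; simp; omega
  have h2 : Disjoint (Finset.range i) (Finset.Ioc i m) := by
    rw [Finset.disjoint_left]; intro j; simp; omega
  rw [h1, Finset.prod_union h2]
  push_cast
  congr 1
  · rw [← Finset.prod_range_reflect, ← Finset.prod_range_add_one_eq_factorial]
    push_cast
    refine Finset.prod_congr rfl fun j hj => ?_
    have : j < i := Finset.mem_range.1 hj
    have h3 : ((i - 1 - j : ℕ) : ℝ) = i - 1 - j := by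
      rw [Nat.cast_sub (by omega), Nat.cast_sub (by omega)]; simp
    rw [h3, show (i : ℝ) - (i - 1 - j) = j + 1 by ring, abs_of_pos (by positivity)]
  · rw [← Finset.prod_range_add_one_eq_factorial]
    push_cast
    refine Finset.prod_nbij' (fun j => i + 1 + j) (fun j => j - i - 1) ?_ ?_ ?_ ?_ ?_
    · intro j; simp; omega
    · intro j; simp; omega
    · intro j; simp; omega
    · intro j; simp; omega
    · intro j _
      push_cast
      rw [abs_of_neg (by linarith [(Nat.cast_nonneg j : (0 : ℝ) ≤ j)])]
      ring

theorem sum_inv_factorial_mul_factorial (m : ℕ) :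
    ∑ i ∈ Finset.range (m + 1), (((i.factorial * (m - i).factorial : ℕ) : ℝ))⁻¹
      = 2 ^ m / m.factorial := by
  have h := (Nat.sum_range_choose m)
  have h' : (∑ i ∈ Finset.range (m + 1), (m.choose i : ℝ)) = 2 ^ m := by exact_mod_cast h
  rw [← h', Finset.sum_div]
  refine Finset.sum_congr rfl fun i hi => ?_
  rw [Nat.cast_choose ℝ (Nat.lt_succ_iff.1 (Finset.mem_range.1 hi))]
  have : (m.factorial : ℝ) ≠ 0 := by exact_mod_cast m.factorial_ne_zero
  push_cast
  field_simp

open Polynomial in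
/-- A polynomial of moderate growth that is small at well separated integers is small in between. -/
theorem norm_eval_le_of_separated {p : ℂ[X]} {N m q : ℕ} (hN : 1 ≤ N) (hq : 1 ≤ q) {x : ℕ → ℕ}
    (hxN : ∀ i ≤ m, x i ≤ N) (hx : ∀ i j, i ≤ j → j ≤ m → x i + q * (j - i) ≤ x j) {B κ : ℝ}
    (hB : ∀ z, ‖z‖ ≤ 7 * N → ‖p.eval z‖ ≤ B) (hκ : ∀ i ≤ m, ‖p.eval (x i : ℂ)‖ ≤ κ)
    {z : ℂ} (hz : ‖z‖ ≤ N) :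
    ‖p.eval z‖ ≤ B * (1 / 3) ^ (m + 1) + 2 * (κ * Real.exp (16 * N / q)) := by
  have hN0 : (0 : ℝ) < N := by exact_mod_cast hN
  have hq0 : (0 : ℝ) < q := by exact_mod_cast hq
  have hκ0 : 0 ≤ κ := (norm_nonneg _).trans (hκ 0 (Nat.zero_le _))
  have hsep : ∀ i ≤ m, ∀ j ≤ m, q * |(i : ℝ) - j| ≤ |(x i : ℝ) - x j| := by
    have aux : ∀ i j, i ≤ j → j ≤ m → q * |(i : ℝ) - j| ≤ |(x i : ℝ) - x j| := by
      intro i j hij hj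
      have h1 : ((x i + q * (j - i) : ℕ) : ℝ) ≤ x j := by exact_mod_cast hx i j hij hj
      push_cast [Nat.cast_sub hij] at h1
      have h2 : (i : ℝ) ≤ j := by exact_mod_cast hij
      rw [abs_of_nonpos (by linarith), abs_sub_comm]
      exact le_trans (by linarith) (le_abs_self _)
    intro i hi j hj
    rcases le_total i j with h | h
    · exact aux i j h hj
    · rw [abs_sub_comm, abs_sub_comm (x i : ℝ)]
      exact aux j i h hi
  have hinj : Set.InjOn (fun i => (x i : ℂ)) (Finset.range (m + 1)) := by
    intro i hi j hj hij
    have hi' : i ≤ m := by simpa [Nat.lt_succ_iff] using hi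
    have hj' : j ≤ m := by simpa [Nat.lt_succ_iff] using hj
    have h1 := hsep i hi' j hj'
    have h2 : x i = x j := by simpa using hij
    rw [h2, sub_self, abs_zero] at h1
    have h3 : |(i : ℝ) - j| ≤ 0 := by
      by_contra h; push Not at h; nlinarith
    have := sub_eq_zero.1 (abs_eq_zero.1 (le_antisymm h3 (abs_nonneg _)))
    exact_mod_cast this
  set L : ℂ[X] := Lagrange.interpolate (Finset.range (m + 1)) (fun i => (x i : ℂ))
    (fun i => p.eval (x i : ℂ)) with hL
  -- The i-th Lagrange basis polynomial is at most (8N/q)^m / (i! (m-i)!); summed over i this is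
  -- (16N/q)^m / m!, a single term of the exponential series. Large gaps q make the loss mild.
  have hLb : ∀ w : ℂ, ‖w‖ ≤ 7 * N → ‖L.eval w‖ ≤ κ * Real.exp (16 * N / q) := by
    intro w hw
    rw [hL, Lagrange.interpolate_apply, eval_finsetSum]
    have hterm : ∀ i ∈ Finset.range (m + 1), ‖(C (p.eval (x i : ℂ)) *
        Lagrange.basis (Finset.range (m + 1)) (fun i => (x i : ℂ)) i).eval w‖ ≤
        κ * ((8 * N) / q) ^ m * (((i.factorial * (m - i).factorial : ℕ) : ℝ))⁻¹ := by
      intro i hi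
      have hi' : i ≤ m := Nat.lt_succ_iff.1 (Finset.mem_range.1 hi)
      have hcard : ((Finset.range (m + 1)).erase i).card = m := by
        rw [Finset.card_erase_of_mem hi, Finset.card_range]; rfl
      rw [eval_mul, eval_C, norm_mul, mul_assoc]
      refine mul_le_mul (hκ i hi') ?_ (norm_nonneg _) hκ0
      rw [factorial_mul_factorial_eq_prod_abs_sub hi', Lagrange.basis, eval_prod, norm_prod]
      have hpow : (8 * N / q : ℝ) ^ m = ∏ _j ∈ (Finset.range (m + 1)).erase i, (8 * N / q : ℝ) := by
        rw [Finset.prod_const, hcard]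
      rw [hpow, ← Finset.prod_inv_distrib, ← Finset.prod_mul_distrib]
      refine Finset.prod_le_prod (fun _ _ => norm_nonneg _) fun j hj => ?_
      have hj' : j ≤ m := Nat.lt_succ_iff.1 (Finset.mem_range.1 (Finset.mem_of_mem_erase hj))
      have hij : 0 < |(i : ℝ) - j| := by
        refine abs_pos.2 (sub_ne_zero.2 ?_)
        exact_mod_cast (Finset.ne_of_mem_erase hj).symm
      have hxj : (x j : ℝ) ≤ N := by exact_mod_cast hxN j hj'
      rw [Lagrange.basisDivisor, eval_mul, eval_C, norm_mul, norm_inv, eval_sub, eval_X, eval_C]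
      have e1 : ‖(x i : ℂ) - x j‖ = |(x i : ℝ) - x j| := by
        rw [← Real.norm_eq_abs, ← Complex.norm_real]; push_cast; rfl
      have e2 : ‖w - x j‖ ≤ 8 * N := by
        refine (norm_sub_le _ _).trans ?_
        rw [Complex.norm_natCast]
        linarith
      rw [e1, div_mul_eq_mul_div, mul_comm, div_eq_mul_inv, mul_assoc, ← mul_inv]
      refine mul_le_mul e2 (inv_anti₀ (by positivity) ?_) (by positivity) (by positivity)
      rw [mul_comm]
      exact hsep i hi' j hj'
    refine (norm_sum_le_of_le _ hterm).trans ?_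
    rw [← Finset.mul_sum, sum_inv_factorial_mul_factorial, mul_assoc]
    refine mul_le_mul_of_nonneg_left ?_ hκ0
    have h3 := Real.pow_div_factorial_le_exp (16 * N / q : ℝ) (by positivity) m
    refine le_trans (le_of_eq ?_) h3
    rw [← mul_div_assoc, ← mul_pow]
    congr 2
    ring
  have hcardT : ((Finset.range (m + 1)).image x).card = m + 1 := by
    rw [Finset.card_image_of_injOn, Finset.card_range]
    intro i hi j hj hij
    exact hinj hi hj (by simpa using hij)
  have hdiff := norm_eval_le_of_zeros (p := p - L) (T := (Finset.range (m + 1)).image x) hN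
    (by
      intro n hn
      obtain ⟨i, hi, rfl⟩ := Finset.mem_image.1 hn
      exact hxN i (Nat.lt_succ_iff.1 (Finset.mem_range.1 hi)))
    (by
      intro n hn
      obtain ⟨i, hi, rfl⟩ := Finset.mem_image.1 hn
      rw [eval_sub, hL, Lagrange.eval_interpolate_at_node (fun i => p.eval (x i : ℂ)) hinj hi,
        sub_self])
    (B := B + κ * Real.exp (16 * N / q)) (by
      intro w hw
      rw [eval_sub]
      exact (norm_sub_le _ _).trans (add_le_add (hB w hw) (hLb w hw))) hz
  rw [hcardT, eval_sub] at hdiff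
  have h1 := hLb z (by linarith)
  have h2 : ‖p.eval z‖ ≤ ‖p.eval z - L.eval z‖ + ‖L.eval z‖ := by
    simpa using norm_add_le (p.eval z - L.eval z) (L.eval z)
  have h3 : κ * Real.exp (16 * N / q) * (1 / 3) ^ (m + 1) ≤ κ * Real.exp (16 * N / q) :=
    mul_le_of_le_one_right (by positivity) (pow_le_one₀ (by norm_num) (by norm_num))
  linarith [add_mul B (κ * Real.exp (16 * N / q)) ((1 / 3 : ℝ) ^ (m + 1))]

/-! ### Separated subsets, density and elementary estimates. -/

/-- A finite set of natural numbers contains a well separated subsequence. -/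
theorem exists_separated_of_finset (T : Finset ℕ) (hT : T.Nonempty) {q : ℕ} (hq : 1 ≤ q) :
    ∃ (m : ℕ) (x : ℕ → ℕ), T.card ≤ q * (m + 1) ∧ (∀ i ≤ m, x i ∈ T) ∧
      ∀ i j, i ≤ j → j ≤ m → x i + q * (j - i) ≤ x j := by
  classical
  have hfin : {n | n ∈ T}.Finite := T.finite_toSet
  have hcard : hfin.toFinset.card = T.card := by
    congr 1; ext; simp
  set y : ℕ → ℕ := Nat.nth (fun n => n ∈ T) with hy
  have hmem : ∀ i < T.card, y i ∈ T := fun i hi =>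
    Nat.nth_mem_of_lt_card hfin (by rw [hcard]; exact hi)
  have hgap : ∀ i k, i + k < T.card → y i + k ≤ y (i + k) := by
    intro i k
    induction k with
    | zero => simp
    | succ k ih =>
      intro h
      have h1 := ih (by omega)
      have h2 : y (i + k) < y (i + (k + 1)) :=
        Nat.nth_strictMonoOn hfin (by simp; omega) (by simp; omega) (by omega)
      omega
  have hpos : 0 < T.card := hT.card_pos
  -- Every q-th element in increasing order; the indices run from 0 to |T| - 1.
  refine ⟨(T.card - 1) / q, fun i => y (q * i), ?_, fun i hi => ?_, fun i j hij hj => ?_⟩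
  · have := Nat.lt_mul_div_succ (T.card - 1) (show 0 < q by omega)
    omega
  · refine hmem _ ?_
    have := (Nat.le_div_iff_mul_le (by omega)).1 hi
    rw [mul_comm] at this
    omega
  · have := (Nat.le_div_iff_mul_le (by omega)).1 hj
    rw [mul_comm] at this
    have h1 : q * i + q * (j - i) = q * j := by rw [← mul_add]; congr 1; omega
    have h2 := hgap (q * i) (q * (j - i)) (by omega)
    rwa [h1] at h2

open Filter in
theorem eventually_le_card_filter {d : ℝ} {S : Set ℕ} [DecidablePred (· ∈ S)] (hd : 0 < d)
    (h : lowerDensity S = d) :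
    ∀ᶠ N : ℕ in atTop, d / 2 * N ≤ ((Finset.Icc 1 N).filter (· ∈ S)).card := by
  have h1 : d / 2 < liminf (fun N : ℕ => ((S ∩ Set.Icc 1 N).ncard : ℝ) / (N : ℝ)) atTop := by
    have : lowerDensity S = liminf (fun N : ℕ => ((S ∩ Set.Icc 1 N).ncard : ℝ) / (N : ℝ)) atTop :=
      rfl
    rw [← this, h]
    linarith
  have h2 : IsBoundedUnder (· ≥ ·) atTop
      (fun N : ℕ => ((S ∩ Set.Icc 1 N).ncard : ℝ) / (N : ℝ)) :=
    isBoundedUnder_of ⟨0, fun N => by positivity⟩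
  filter_upwards [eventually_lt_of_lt_liminf h1 h2, eventually_ge_atTop 1] with N hN hN1
  have hN0 : (0 : ℝ) < N := by exact_mod_cast hN1
  rw [lt_div_iff₀ hN0] at hN
  have h3 : S ∩ Set.Icc 1 N = ↑((Finset.Icc 1 N).filter (· ∈ S)) := by
    ext n
    rw [Finset.coe_filter, Set.mem_inter_iff, Set.mem_Icc, Set.mem_ofPred_eq, Finset.mem_Icc,
      and_comm]
  rw [h3, Set.ncard_coe_finset] at hN
  exact hN.le

/-- The surviving indices are comparable to N, so that powers |c|^n become exponential in N. -/
theorem le_card_filter_lt {d : ℝ} (hd : 0 < d) {N : ℕ} {T : Finset ℕ} (hT : T ⊆ Finset.Icc 1 N)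
    (hc : d / 2 * N ≤ T.card) :
    d / 4 * N ≤ (T.filter fun n : ℕ => d / 4 * N < n).card := by
  have h1 := T.card_filter_add_card_filter_not (p := fun n : ℕ => d / 4 * N < n)
  have h2 : (T.filter fun n : ℕ => ¬ d / 4 * N < n) ⊆ Finset.Icc 1 ⌊d / 4 * N⌋₊ := by
    intro n hn
    rw [Finset.mem_filter] at hn
    have := Finset.mem_Icc.1 (hT hn.1)
    exact Finset.mem_Icc.2 ⟨this.1, Nat.le_floor (not_lt.1 hn.2)⟩
  have h3 := Finset.card_le_card h2
  rw [Nat.card_Icc, Nat.add_sub_cancel] at h3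
  have h4 : ((T.filter fun n : ℕ => ¬ d / 4 * N < n).card : ℝ) ≤ d / 4 * N :=
    le_trans (by exact_mod_cast h3) (Nat.floor_le (by positivity))
  have h5 : ((T.filter fun n : ℕ => d / 4 * N < n).card : ℝ) +
      (T.filter fun n : ℕ => ¬ d / 4 * N < n).card = T.card := by exact_mod_cast h1
  linarith

theorem one_third_pow_le_exp_neg (n : ℕ) : (1 / 3 : ℝ) ^ n ≤ Real.exp (-n) := by
  have h : (1 / 3 : ℝ) ≤ Real.exp (-1) := by
    rw [Real.exp_neg, ← one_div]
    exact one_div_le_one_div_of_le (Real.exp_pos 1) (by linarith [Real.exp_one_lt_d9])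
  calc (1 / 3 : ℝ) ^ n ≤ Real.exp (-1) ^ n := by gcongr
    _ = Real.exp (-n) := by rw [← Real.exp_nat_mul]; congr 1; ring

open Filter in
theorem eventually_const_mul_exp_neg_lt (a : ℝ) {b y : ℝ} (hb : 0 < b) (hy : 0 < y) :
    ∀ᶠ N : ℕ in atTop, a * Real.exp (-(b * N)) < y := by
  have h : Tendsto (fun N : ℕ => a * Real.exp (-(b * N))) atTop (nhds (a * 0)) :=
    (Real.tendsto_exp_neg_atTop_nhds_zero.comp
      (tendsto_natCast_atTop_atTop.const_mul_atTop hb)).const_mul a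
  rw [mul_zero] at h
  exact h.eventually_lt_const hy

/-! ### The exponent c is nearly, then exactly, unimodular. -/

open Filter in
/-- If `F (z) exp (-c z)` grows slowly on a large disk and many derivatives of `F` at the origin
are unimodular, then `c` is nearly unimodular. -/
theorem exists_eventually_norm_mem_Icc {d δ : ℝ} (hd : 0 < d) (hδ : 0 < δ) (hδ1 : δ ≤ 1 / 2) :
    ∃ ε : ℝ, 0 < ε ∧ ∀ F : ℂ → ℂ, Differentiable ℂ F → ∀ (T : ℕ → Finset ℕ),
      (∀ N, T N ⊆ Finset.Icc 1 N) → (∀ N, ∀ n ∈ T N, ‖iteratedDeriv n F 0‖ = 1) →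
      (∀ᶠ N : ℕ in atTop, d / 2 * N ≤ (T N).card) → ∀ C : ℝ, ∀ᶠ N : ℕ in atTop,
      ∀ c : ℂ, ‖c‖ ≤ C → (∀ z : ℂ, ‖z‖ ≤ 32 * N → ‖F z * Complex.exp (-(c * z))‖ ≤
        Real.exp (ε * N)) → 1 - δ ≤ ‖c‖ ∧ ‖c‖ ≤ 1 + δ := by
  -- The gap q makes the interpolation loss exp(16N/q) at most half, in the exponent, of the gain
  -- exp(-δdN/8).
  obtain ⟨q, hq⟩ := exists_nat_ge (256 / (δ * d))
  have hq0 : (0 : ℝ) < q := lt_of_lt_of_le (by positivity) hq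
  have hq1 : 1 ≤ q := by exact_mod_cast hq0
  have hqd : 16 / (q : ℝ) ≤ δ * d / 16 := by
    rw [div_le_iff₀ (by positivity)] at hq
    rw [div_le_iff₀ hq0]
    linarith
  -- The three bounds serve, in order, to exclude |c| < 1/2, |c| < 1 - δ and |c| > 1 + δ.
  obtain ⟨ε, hε, hε1, hε2, hε3⟩ : ∃ ε : ℝ, 0 < ε ∧ ε ≤ d / 32 ∧ ε ≤ δ * d / 8 ∧
      ε ≤ d / (8 * q) :=
    ⟨min (d / 32) (min (δ * d / 8) (d / (8 * q))), by positivity, min_le_left _ _,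
      (min_le_right _ _).trans (min_le_left _ _), (min_le_right _ _).trans (min_le_right _ _)⟩
  refine ⟨ε, hε, fun F hF T hT hT1 hcard C => ?_⟩
  -- This index does not depend on N, so |c|^n₀ ≤ C^n₀ stays bounded while p(n₀) is shown to decay.
  obtain ⟨n₀, hn₀⟩ : ∃ n₀, ‖iteratedDeriv n₀ F 0‖ = 1 := by
    obtain ⟨N, hN, hN1⟩ := (hcard.and (eventually_ge_atTop 1)).exists
    have hN0 : (0 : ℝ) < N := by exact_mod_cast hN1
    have : 0 < (T N).card := by
      have : (0 : ℝ) < (T N).card := lt_of_lt_of_le (by positivity) hN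
      exact_mod_cast this
    obtain ⟨n, hn⟩ := Finset.card_pos.1 this
    exact ⟨n, hT1 N n hn⟩
  filter_upwards [hcard, eventually_ge_atTop 1, eventually_ge_atTop n₀,
    eventually_const_mul_exp_neg_lt 2 (show 0 < δ * d / 8 by positivity) one_pos,
    eventually_const_mul_exp_neg_lt (C ^ n₀ * 2) (show 0 < d / (8 * q) by positivity)
      (show (0 : ℝ) < 1 / 2 by norm_num),
    eventually_const_mul_exp_neg_lt (C ^ n₀ * 2) (show 0 < δ * d / 16 by positivity)
      (show (0 : ℝ) < 1 / 2 by norm_num)] with N hNc hN1 hNn₀ hNa hNb hNd c hcC hcb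
  have hN0 : (0 : ℝ) < N := by exact_mod_cast hN1
  set T' := (T N).filter fun n : ℕ => d / 4 * N < n with hT'
  have hT'card : d / 4 * N ≤ T'.card := le_card_filter_lt hd (hT N) hNc
  have hT'ne : T'.Nonempty := by
    rw [← Finset.card_pos]
    have : (0 : ℝ) < T'.card := lt_of_lt_of_le (by positivity) hT'card
    exact_mod_cast this
  have hT'm : ∀ n ∈ T', n ≤ N ∧ d / 4 * N < n ∧ ‖iteratedDeriv n F 0‖ = 1 := by
    intro n hn
    rw [hT', Finset.mem_filter] at hn
    exact ⟨(Finset.mem_Icc.1 (hT N hn.1)).2, hn.2, hT1 N n hn.1⟩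
  obtain ⟨n₁, hn₁⟩ := hT'ne
  obtain ⟨hn₁N, hn₁d, hn₁1⟩ := hT'm n₁ hn₁
  have hhalf : 1 / 2 ≤ ‖c‖ := by
    by_contra hlt
    push Not at hlt
    have h1 := norm_iteratedDeriv_zero_le_pow hF (by positivity) hcb hn₁N
    have h2 : (N : ℝ) / (32 * N) = 1 / 32 := by field_simp
    rw [hn₁1, h2] at h1
    have h3 : (1 / 32 + ‖c‖) ^ n₁ ≤ Real.exp (-(1 / 4 * n₁)) := by
      have : 1 / 32 + ‖c‖ ≤ Real.exp (-(1 / 4)) := by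
        linarith [Real.add_one_le_exp (-(1 / 4) : ℝ)]
      calc (1 / 32 + ‖c‖) ^ n₁ ≤ Real.exp (-(1 / 4)) ^ n₁ := by gcongr
        _ = _ := by rw [← Real.exp_nat_mul]; congr 1; ring
    have h4 : (1 : ℝ) ≤ Real.exp (ε * N + -(1 / 4 * n₁)) := by
      rw [Real.exp_add]
      exact h1.trans (by gcongr)
    rw [Real.one_le_exp_iff] at h4
    have h5 : ε * N ≤ d / 32 * N := by gcongr
    have h6 : 0 < d * N := by positivity
    linarith
  obtain ⟨p, hp, hpb⟩ := exists_polynomial_eval_eq hF hhalf hN1 hcb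
  have hpn : ∀ n ≤ N, ‖iteratedDeriv n F 0‖ = ‖c‖ ^ n * ‖p.eval (n : ℂ)‖ := by
    intro n hn
    rw [hp n hn, norm_mul, norm_pow]
  refine ⟨?_, ?_⟩
  · by_contra hlt
    push Not at hlt
    have h1 := hpn n₁ hn₁N
    have h2 := hpb n₁ (by
      rw [Complex.norm_natCast]
      have : (n₁ : ℝ) ≤ N := by exact_mod_cast hn₁N
      linarith)
    have h3 : ‖c‖ ^ n₁ ≤ Real.exp (-(δ * n₁)) := by
      have : ‖c‖ ≤ Real.exp (-δ) := by linarith [Real.add_one_le_exp (-δ)]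
      calc ‖c‖ ^ n₁ ≤ Real.exp (-δ) ^ n₁ := by gcongr
        _ = _ := by rw [← Real.exp_nat_mul]; congr 1; ring
    have h4 : (1 : ℝ) ≤ 2 * Real.exp (-(δ * d / 8 * N)) := by
      calc (1 : ℝ) = ‖c‖ ^ n₁ * ‖p.eval (n₁ : ℂ)‖ := by rw [← h1, hn₁1]
        _ ≤ Real.exp (-(δ * n₁)) * (2 * Real.exp (ε * N)) := by gcongr
        _ = 2 * Real.exp (-(δ * n₁) + ε * N) := by rw [Real.exp_add]; ring
        _ ≤ _ := by
          gcongr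
          have e1 : ε * N ≤ δ * d / 8 * N := by gcongr
          have e2 : δ * (d / 4 * N) ≤ δ * n₁ := by gcongr
          linarith
    linarith
  -- For |c| > 1 + δ, unimodularity makes |p(n)| = |c|^(-n) exponentially small on the separated
  -- nodes, hence also at n₀.
  · by_contra hlt
    push Not at hlt
    obtain ⟨m, x, hm, hxT, hx⟩ := exists_separated_of_finset T' ⟨n₁, hn₁⟩ hq1
    have hexp : Real.exp (δ / 2) ≤ ‖c‖ := by
      refine le_trans ?_ hlt.le
      have h1 := Real.add_one_le_exp (-(δ / 2))
      have h2 : Real.exp (δ / 2) * Real.exp (-(δ / 2)) = 1 := by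
        rw [← Real.exp_add]; simp
      have h3 := Real.exp_pos (δ / 2)
      nlinarith
    have hκ : ∀ i ≤ m, ‖p.eval (x i : ℂ)‖ ≤ Real.exp (-(δ * d / 8 * N)) := by
      intro i hi
      obtain ⟨g1, g2, g3⟩ := hT'm _ (hxT i hi)
      have h1 := hpn _ g1
      rw [g3] at h1
      have h2 : Real.exp (δ * d / 8 * N) ≤ ‖c‖ ^ x i := by
        calc Real.exp (δ * d / 8 * N) ≤ Real.exp (x i * (δ / 2)) := by
              refine Real.exp_le_exp.2 ?_
              have : d / 4 * N * (δ / 2) ≤ x i * (δ / 2) := by gcongr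
              linarith
          _ = Real.exp (δ / 2) ^ x i := by rw [Real.exp_nat_mul]
          _ ≤ _ := by gcongr
      have h3 : Real.exp (δ * d / 8 * N) * ‖p.eval (x i : ℂ)‖ ≤ 1 := by
        rw [h1]
        gcongr
      rw [Real.exp_neg, ← one_div, le_div_iff₀ (Real.exp_pos _)]
      linarith
    have h1 := norm_eval_le_of_separated hN1 hq1 (fun i hi => (hT'm _ (hxT i hi)).1) hx hpb hκ
      (z := n₀) (by rw [Complex.norm_natCast]; exact_mod_cast hNn₀)
    have h2 : Real.exp (-(δ * d / 8 * N)) * Real.exp (16 * N / q) ≤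
        Real.exp (-(δ * d / 16 * N)) := by
      rw [← Real.exp_add]
      refine Real.exp_le_exp.2 ?_
      have : 16 * N / q = 16 / (q : ℝ) * N := by ring
      have : 16 / (q : ℝ) * N ≤ δ * d / 16 * N := by gcongr
      linarith
    have h3 : 2 * Real.exp (ε * N) * (1 / 3) ^ (m + 1) ≤ 2 * Real.exp (-(d / (8 * q) * N)) := by
      calc 2 * Real.exp (ε * N) * (1 / 3) ^ (m + 1)
          ≤ 2 * Real.exp (ε * N) * Real.exp (-(m + 1 : ℕ)) := by
            gcongr
            exact one_third_pow_le_exp_neg _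
        _ = 2 * Real.exp (ε * N + -(m + 1 : ℕ)) := by rw [Real.exp_add]; ring
        _ ≤ _ := by
          gcongr
          have g1 : (T'.card : ℝ) ≤ q * (m + 1 : ℕ) := by exact_mod_cast hm
          have g2 : d / 4 * N / q ≤ (m + 1 : ℕ) := by
            rw [div_le_iff₀ hq0]
            linarith
          have g3 : ε * N ≤ d / (8 * q) * N := by gcongr
          have g4 : d / 4 * N / q = 2 * (d / (8 * q) * N) := by field_simp; norm_num
          linarith
    have h4 := hpn n₀ hNn₀
    rw [hn₀] at h4
    have hC : ‖c‖ ^ n₀ ≤ C ^ n₀ := by gcongr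
    have hC0 : 0 ≤ C ^ n₀ := (by positivity : 0 ≤ ‖c‖ ^ n₀).trans hC
    have h5 : (1 : ℝ) ≤ C ^ n₀ * (2 * Real.exp (-(d / (8 * q) * N)) +
        2 * Real.exp (-(δ * d / 16 * N))) := by
      calc (1 : ℝ) = ‖c‖ ^ n₀ * ‖p.eval (n₀ : ℂ)‖ := h4
        _ ≤ _ := mul_le_mul hC (by linarith) (norm_nonneg _) hC0
    linarith

open Filter in
theorem exists_frequently_unimodular {d K : ℝ} (hd : 0 < d) (hK : 0 < K) :
    ∃ χ : ℝ, 0 < χ ∧ ∀ F : ℂ → ℂ, Differentiable ℂ F → ∀ (T : ℕ → Finset ℕ),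
      (∀ N, T N ⊆ Finset.Icc 1 N) → (∀ N, ∀ n ∈ T N, ‖iteratedDeriv n F 0‖ = 1) →
      (∀ᶠ N : ℕ in atTop, d / 2 * N ≤ (T N).card) → (∃ z, F z ≠ 0) →
      (∃ B : ℝ, ∀ z, ‖F z‖ ≤ B * Real.exp (K * ‖z‖)) →
      (∃ᶠ R : ℝ in atTop, (zeroCount F R : ℝ) / R < χ) →
      ∃ᶠ N : ℕ in atTop, ∃ c : ℂ, ‖c‖ = 1 ∧ ∀ z : ℂ, ‖z‖ ≤ 32 * N →
        ‖F z * Complex.exp (-(c * z))‖ ≤ Real.exp (d / 8 * N) := by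
  -- Replacing c by c/|c| costs exp(32δN) ≤ exp(dN/16), half of the allowed exponent.
  obtain ⟨δ, hδ, hδ1, hδd⟩ : ∃ δ : ℝ, 0 < δ ∧ δ ≤ 1 / 2 ∧ δ ≤ d / 512 :=
    ⟨min (1 / 2) (d / 512), by positivity, min_le_left _ _, min_le_right _ _⟩
  obtain ⟨ε, hε, hF⟩ := exists_eventually_norm_mem_Icc hd hδ hδ1
  obtain ⟨χ, hχ, hfreq⟩ := exists_frequently_norm_mul_exp_neg_le (A := 32)
    (ε := min ε (d / 16)) hK (by norm_num) (by positivity)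
  refine ⟨χ, hχ, fun F hFd T hT hT1 hcard hne hB hz => ?_⟩
  refine ((hfreq F hFd hne hB hz).and_eventually (hF F hFd T hT hT1 hcard (20 * K))).mono ?_
  rintro N ⟨⟨c, hc, hcb⟩, hN⟩
  obtain ⟨h1, h2⟩ := hN c hc fun z hz => (hcb z hz).trans (by
    gcongr
    exact min_le_left _ _)
  have hc0 : 0 < ‖c‖ := by linarith
  have hc0' : (‖c‖ : ℂ) ≠ 0 := by exact_mod_cast hc0.ne'
  refine ⟨c / ‖c‖, ?_, fun z hz => ?_⟩
  · rw [norm_div, Complex.norm_real, norm_norm, div_self hc0.ne']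
  · have h3 : ‖c - c / ‖c‖‖ ≤ δ := by
      have : c - c / ‖c‖ = c / ‖c‖ * ((‖c‖ - 1 : ℝ) : ℂ) := by
        push_cast
        field_simp
      rw [this, norm_mul, norm_div, Complex.norm_real, norm_norm, div_self hc0.ne', one_mul,
        Complex.norm_real, Real.norm_eq_abs, abs_le]
      constructor <;> linarith
    have h4 : F z * Complex.exp (-(c / ‖c‖ * z)) =
        F z * Complex.exp (-(c * z)) * Complex.exp ((c - c / ‖c‖) * z) := by
      rw [mul_assoc, ← Complex.exp_add]
      congr 2
      ring
    rw [h4, norm_mul]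
    calc ‖F z * Complex.exp (-(c * z))‖ * ‖Complex.exp ((c - c / ‖c‖) * z)‖
        ≤ Real.exp (min ε (d / 16) * N) * Real.exp (d / 16 * N) := by
          refine mul_le_mul (hcb z hz) ?_ (norm_nonneg _) (Real.exp_pos _).le
          refine (Complex.norm_exp_le_exp_norm _).trans (Real.exp_le_exp.2 ?_)
          rw [norm_mul]
          calc ‖c - c / ‖c‖‖ * ‖z‖ ≤ d / 512 * (32 * N) := by
                gcongr
                exact h3.trans hδd
            _ = _ := by ring
      _ ≤ Real.exp (d / 16 * N) * Real.exp (d / 16 * N) := by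
          gcongr
          exact min_le_right _ _
      _ = _ := by
          rw [← Real.exp_add]
          congr 1
          ring

/-! ### Rigidity: unimodular coefficients in geometric progression. -/

theorem eval_map_conj (p : Polynomial ℂ) (z : ℂ) :
    (p.map (starRingEnd ℂ)).eval z = starRingEnd ℂ (p.eval (starRingEnd ℂ z)) := by
  have := Polynomial.eval_map_apply (f := starRingEnd ℂ) (p := p) (starRingEnd ℂ z)
  rwa [Complex.conj_conj] at this

open Polynomial in
/-- A polynomial of moderate growth, unimodular at many integers, is nearly unimodular on the real
line and zero-free. -/
theorem norm_eval_mul_eval_map_conj_sub_one_le {d : ℝ} (hd : 0 < d) {p : ℂ[X]} {T : Finset ℕ}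
    {N : ℕ} (hN : 1 ≤ N) (hT : T ⊆ Finset.Icc 1 N) (hT1 : ∀ n ∈ T, ‖p.eval (n : ℂ)‖ = 1)
    (hcard : d / 2 * N ≤ T.card) (hp : ∀ z, ‖z‖ ≤ 7 * N → ‖p.eval z‖ ≤ 2 * Real.exp (d / 8 * N))
    {z : ℂ} (hz : ‖z‖ ≤ N) :
    ‖p.eval z * starRingEnd ℂ (p.eval (starRingEnd ℂ z)) - 1‖ ≤ 5 * Real.exp (-(d / 4 * N)) := by
  -- At integers this polynomial equals |p(n)|² - 1, so it vanishes on T. Its dN/2 zeroes gain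
  -- exp(-dN/2) against a growth of 5 exp(dN/4).
  have heval : ∀ w, (p * p.map (starRingEnd ℂ) - 1).eval w =
      p.eval w * starRingEnd ℂ (p.eval (starRingEnd ℂ w)) - 1 := by
    intro w
    rw [eval_sub, eval_mul, eval_map_conj, eval_one]
  have h1 := norm_eval_le_of_zeros (p := p * p.map (starRingEnd ℂ) - 1) hN
    (fun n hn => (Finset.mem_Icc.1 (hT hn)).2) (fun n hn => by
      rw [heval, Complex.conj_natCast, Complex.mul_conj, Complex.normSq_eq_norm_sq, hT1 n hn]
      simp) (B := 5 * Real.exp (d / 4 * N)) (fun w hw => by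
      rw [heval]
      refine (norm_sub_le _ _).trans ?_
      rw [norm_mul, Complex.norm_conj, norm_one]
      have g1 := hp w hw
      have g2 := hp (starRingEnd ℂ w) (by rwa [Complex.norm_conj])
      have g3 : Real.exp (d / 4 * N) = Real.exp (d / 8 * N) * Real.exp (d / 8 * N) := by
        rw [← Real.exp_add]; congr 1; ring
      have g4 : 1 ≤ Real.exp (d / 4 * N) := Real.one_le_exp (by positivity)
      have g5 := mul_le_mul g1 g2 (norm_nonneg _) (by positivity)
      linarith) hz
  rw [heval] at h1
  refine h1.trans ?_
  calc 5 * Real.exp (d / 4 * N) * (1 / 3) ^ T.card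
      ≤ 5 * Real.exp (d / 4 * N) * Real.exp (-T.card) := by
        gcongr
        exact one_third_pow_le_exp_neg _
    _ = 5 * Real.exp (d / 4 * N + -T.card) := by rw [Real.exp_add]; ring
    _ ≤ _ := by
        gcongr
        linarith

/-- For equally spaced points the constant and linear parts of log f cancel in the second
difference; only the errors remain. -/
theorem norm_mul_sub_sq_le {f : ℂ → ℂ} {b : ℂ} {e : ℂ → ℂ} {u v w : ℂ} {y : ℝ}
    (hu : f u = f 0 * Complex.exp (b * u + e u)) (hv : f v = f 0 * Complex.exp (b * v + e v))
    (hw : f w = f 0 * Complex.exp (b * w + e w)) (huw : u + w = 2 * v) (hy : 4 * y ≤ 1)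
    (hue : ‖e u‖ ≤ y) (hve : ‖e v‖ ≤ y) (hwe : ‖e w‖ ≤ y) :
    ‖f u * f w - f v ^ 2‖ ≤ ‖f v‖ ^ 2 * (8 * y) := by
  have h1 : f u * f w = f v ^ 2 * Complex.exp (e u + e w - 2 * e v) := by
    rw [hu, hv, hw, mul_pow, ← Complex.exp_nat_mul, mul_assoc (f 0 ^ 2), ← Complex.exp_add,
      mul_mul_mul_comm, ← Complex.exp_add, ← sq]
    congr 2
    push_cast
    linear_combination b * huw
  have h2 : ‖e u + e w - 2 * e v‖ ≤ 4 * y := by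
    refine (norm_sub_le _ _).trans ?_
    have := norm_add_le (e u) (e w)
    rw [norm_mul, Complex.norm_ofNat]
    linarith
  have h3 := Complex.norm_exp_sub_one_le (h2.trans hy)
  have h4 : f u * f w - f v ^ 2 = f v ^ 2 * (Complex.exp (e u + e w - 2 * e v) - 1) := by
    rw [h1]; ring
  rw [h4, norm_mul, norm_pow]
  gcongr
  linarith

-- Estimates valid for infinitely many N become exact identities when their left side does not
-- depend on N.
open Filter in
theorem eq_zero_of_frequently_norm_le {E : Type*} [NormedAddCommGroup E] {a : E} {u : ℕ → ℝ}
    (hu : Tendsto u atTop (nhds 0)) (h : ∃ᶠ N in atTop, ‖a‖ ≤ u N) : a = 0 := by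
  by_contra ha
  obtain ⟨N, h1, h2⟩ := (h.and_eventually (hu.eventually_lt_const (norm_pos_iff.2 ha))).exists
  exact absurd h1 (not_le.2 h2)

open Filter in
/-- The derivatives of `F` at the origin are unimodular and form a geometric progression. -/
theorem unimodular_geometric_of_frequently {d : ℝ} (hd : 0 < d) {F : ℂ → ℂ}
    (hF : Differentiable ℂ F) {T : ℕ → Finset ℕ} (hT : ∀ N, T N ⊆ Finset.Icc 1 N)
    (hT1 : ∀ N, ∀ n ∈ T N, ‖iteratedDeriv n F 0‖ = 1)
    (hcard : ∀ᶠ N : ℕ in atTop, d / 2 * N ≤ (T N).card)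
    (hfreq : ∃ᶠ N : ℕ in atTop, ∃ c : ℂ, ‖c‖ = 1 ∧ ∀ z : ℂ, ‖z‖ ≤ 32 * N →
        ‖F z * Complex.exp (-(c * z))‖ ≤ Real.exp (d / 8 * N)) :
    (∀ n, ‖iteratedDeriv n F 0‖ = 1) ∧ ∀ n, iteratedDeriv n F 0 * iteratedDeriv (n + 2) F 0 =
      iteratedDeriv (n + 1) F 0 ^ 2 := by
  have key : ∃ᶠ N : ℕ in atTop, ∃ (c : ℂ) (p : Polynomial ℂ), ‖c‖ = 1 ∧
      (∀ n ≤ N, iteratedDeriv n F 0 = c ^ n * p.eval (n : ℂ)) ∧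
      (∀ z, ‖z‖ ≤ 7 * N → ‖p.eval z‖ ≤ 2 * Real.exp (d / 8 * N)) ∧
      ∀ z, ‖z‖ ≤ N → ‖p.eval z * starRingEnd ℂ (p.eval (starRingEnd ℂ z)) - 1‖ ≤
        5 * Real.exp (-(d / 4 * N)) := by
    refine (hfreq.and_eventually (hcard.and (eventually_ge_atTop 1))).mono ?_
    rintro N ⟨⟨c, hc, hcb⟩, hNc, hN1⟩
    obtain ⟨p, hp, hpb⟩ := exists_polynomial_eval_eq hF (by rw [hc]; norm_num) hN1 hcb
    refine ⟨c, p, hc, hp, hpb, fun z hz =>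
      norm_eval_mul_eval_map_conj_sub_one_le hd hN1 (hT N) (fun n hn => ?_) hNc hpb hz⟩
    have h1 := hT1 N n hn
    rwa [hp n (Finset.mem_Icc.1 (hT N hn)).2, norm_mul, norm_pow, hc, one_pow, one_mul] at h1
  have hexp0 : Tendsto (fun N : ℕ => 5 * Real.exp (-(d / 4 * N))) atTop (nhds 0) := by
    have h : Tendsto (fun N : ℕ => 5 * Real.exp (-(d / 4 * N))) atTop (nhds (5 * 0)) :=
      (Real.tendsto_exp_neg_atTop_nhds_zero.comp
        (tendsto_natCast_atTop_atTop.const_mul_atTop (by positivity))).const_mul 5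
    rwa [mul_zero] at h
  have huni : ∀ n, ‖iteratedDeriv n F 0‖ = 1 := by
    intro n
    have h0 : ((‖iteratedDeriv n F 0‖ ^ 2 - 1 : ℝ) : ℂ) = 0 := by
      refine eq_zero_of_frequently_norm_le hexp0
        ((key.and_eventually (eventually_ge_atTop n)).mono ?_)
      rintro N ⟨⟨c, p, hc, hp, -, hpb⟩, hN⟩
      have h1 := hpb n (by rw [Complex.norm_natCast]; exact_mod_cast hN)
      rw [Complex.conj_natCast, Complex.mul_conj, Complex.normSq_eq_norm_sq] at h1
      rw [hp n hN, norm_mul, norm_pow, hc, one_pow, one_mul]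
      push_cast at h1 ⊢
      exact h1
    have h1 : ‖iteratedDeriv n F 0‖ ^ 2 - 1 = 0 := by exact_mod_cast h0
    exact (pow_eq_one_iff_of_nonneg (norm_nonneg _) two_ne_zero).1 (by linarith)
  refine ⟨huni, fun n => sub_eq_zero.1 ?_⟩
  -- The quadratic error 32M(k/N)² with M = dN/4 is 8dk²/N, here with k ≤ n + 2.
  have hu : Tendsto (fun N : ℕ => 8 * (8 * d * (n + 2) ^ 2 / (N : ℝ))) atTop (nhds 0) := by
    have h := (tendsto_const_div_atTop_nhds_zero_nat (8 * d * (n + 2) ^ 2)).const_mul 8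
    rwa [mul_zero] at h
  refine eq_zero_of_frequently_norm_le hu ((key.and_eventually
    ((hu.eventually_lt_const one_pos).and ((hexp0.eventually_lt_const one_pos).and
    ((eventually_ge_atTop (2 * (n + 2))).and
    (eventually_const_mul_exp_neg_lt 2 (show 0 < d / 8 by positivity) one_pos))))).mono ?_)
  rintro N ⟨⟨c, p, hc, hp, hpb, hpc⟩, hN1, hN2, hNn, hN3⟩
  have hN0 : (0 : ℝ) < N := by
    have : 0 < N := by omega
    exact_mod_cast this
  have hpn : ∀ k ≤ N, ‖p.eval (k : ℂ)‖ = 1 := by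
    intro k hk
    have h1 := huni k
    rwa [hp k hk, norm_mul, norm_pow, hc, one_pow, one_mul] at h1
  have hp0 : ‖p.eval 0‖ = 1 := by simpa using hpn 0 (Nat.zero_le _)
  have hlarge : 2 * Real.exp (d / 8 * N) ≤ Real.exp (d / 4 * N) := by
    have h1 : 2 * Real.exp (-(d / 8 * N)) * Real.exp (d / 4 * N) = 2 * Real.exp (d / 8 * N) := by
      rw [mul_assoc, ← Real.exp_add]
      congr 2
      ring
    rw [← h1]
    exact mul_le_of_le_one_left (Real.exp_pos _).le hN3.le
  -- A zero of p in the disk would make the quantity in `hpc` equal to 1, against its bound below 1.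
  obtain ⟨b, e, -, hbe⟩ := exists_eq_mul_exp_linear (R := N) (M := d / 4 * N)
    (f := fun z => p.eval z) hN0 (by positivity) p.differentiable.differentiableOn
    (by
      intro z hz h
      have h1 := hpc z (by simpa using (mem_ball_zero_iff.1 hz).le)
      rw [h, zero_mul, zero_sub, norm_neg, norm_one] at h1
      linarith)
    (by
      intro z hz
      rw [hp0, one_mul]
      exact (hpb z (by linarith [mem_ball_zero_iff.1 hz])).trans hlarge)
  have hNn' : 2 * ((n : ℝ) + 2) ≤ N := by exact_mod_cast hNn
  have hk : ∀ k ≤ n + 2, p.eval (k : ℂ) = p.eval 0 * Complex.exp (b * k + e k) ∧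
      ‖e k‖ ≤ 8 * d * (n + 2) ^ 2 / (N : ℝ) := by
    intro k hk
    have hk' : (k : ℝ) ≤ n + 2 := by exact_mod_cast hk
    obtain ⟨h1, h2⟩ := hbe k (by rw [Complex.norm_natCast]; linarith)
    refine ⟨h1, h2.trans ?_⟩
    rw [Complex.norm_natCast]
    calc 32 * (d / 4 * N) * ((k : ℝ) / N) ^ 2 = 8 * d * (k : ℝ) ^ 2 / N := by field_simp; ring
      _ ≤ _ := by gcongr
  have hfin := norm_mul_sub_sq_le (f := fun z => p.eval z) (hk n (by omega)).1
    (hk (n + 1) (by omega)).1 (hk (n + 2) le_rfl).1 (by push_cast; ring) (by linarith)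
    (hk n (by omega)).2 (hk (n + 1) (by omega)).2 (hk (n + 2) le_rfl).2
  simp only [hpn (n + 1) (by omega), one_pow, one_mul] at hfin
  refine le_trans (le_of_eq ?_) hfin
  rw [hp n (by omega), hp (n + 1) (by omega), hp (n + 2) (by omega)]
  have h5 : c ^ n * p.eval (n : ℂ) * (c ^ (n + 2) * p.eval ((n + 2 : ℕ) : ℂ)) -
      (c ^ (n + 1) * p.eval ((n + 1 : ℕ) : ℂ)) ^ 2 = c ^ (2 * n + 2) *
      (p.eval (n : ℂ) * p.eval ((n + 2 : ℕ) : ℂ) - p.eval ((n + 1 : ℕ) : ℂ) ^ 2) := by ring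
  rw [h5, norm_mul, norm_pow, hc, one_pow, one_mul]

theorem eq_mul_exp_of_geometric {ω : ℕ → ℂ} {F : ℂ → ℂ}
    (h : ∀ z : ℂ, HasSum (fun n : ℕ => ω n * (z ^ n / (n.factorial : ℂ))) (F z))
    (h1 : ∀ n, ‖ω n‖ = 1) (h2 : ∀ n, ω n * ω (n + 2) = ω (n + 1) ^ 2) :
    ∃ Θ α : ℂ, ‖Θ‖ = 1 ∧ ‖α‖ = 1 ∧ ∀ z : ℂ, F z = Θ * Complex.exp (α * z) := by
  have h0 : ∀ n, ω n ≠ 0 := fun n => norm_pos_iff.1 (by rw [h1]; exact one_pos)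
  have hstep : ∀ n, ω (n + 1) = ω 1 / ω 0 * ω n := by
    intro n
    induction n with
    | zero => rw [div_mul_cancel₀ _ (h0 0)]
    | succ n ih =>
      refine mul_left_cancel₀ (h0 n) ?_
      rw [h2, sq]
      nth_rewrite 1 [ih]
      ring
  have hgeo : ∀ n, ω n = ω 0 * (ω 1 / ω 0) ^ n := by
    intro n
    induction n with
    | zero => simp
    | succ n ih => rw [hstep, ih, pow_succ]; ring
  refine ⟨ω 0, ω 1 / ω 0, h1 0, by rw [norm_div, h1, h1, div_one], fun z => ?_⟩
  refine (h z).unique ?_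
  have h3 := (NormedSpace.expSeries_div_hasSum_exp (ω 1 / ω 0 * z)).mul_left (ω 0)
  rw [← Complex.exp_eq_exp_ℂ] at h3
  have h4 : (fun n : ℕ => ω n * (z ^ n / (n.factorial : ℂ))) =
      fun n : ℕ => ω 0 * ((ω 1 / ω 0 * z) ^ n / (n.factorial : ℂ)) := by
    funext n
    rw [hgeo n, mul_pow]
    ring
  rw [h4]
  exact h3

theorem theorem3 (d σ : ℝ) (hd : 0 < d) (hσ : 0 ≤ σ) :
    ∃ χ : ℝ, 0 < χ ∧
      ∀ (ω : ℕ → ℂ) (F : ℂ → ℂ),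
        (∀ z : ℂ, HasSum (fun n : ℕ => ω n * (z ^ n / (n.factorial : ℂ))) (F z)) →
        IsExpTypeAtMost σ F →
        lowerDensity {n : ℕ | ‖ω n‖ = 1} = d →
        (χ : EReal) ≤
            Filter.liminf (fun R : ℝ => (((zeroCount F R : ℝ) / R : ℝ) : EReal)) Filter.atTop ∨
          ∃ Θ α : ℂ, ‖Θ‖ = 1 ∧ ‖α‖ = 1 ∧ ∀ z : ℂ, F z = Θ * Complex.exp (α * z) := by
  classical
  -- Any fixed growth rate above σ suffices; σ + 1 is also positive when σ = 0.
  obtain ⟨χ, hχ, hmain⟩ := exists_frequently_unimodular hd (show 0 < σ + 1 by linarith)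
  refine ⟨χ, hχ, fun ω F hsum hF hdens => ?_⟩
  rw [or_iff_not_imp_left, not_le]
  intro hlt
  have hω : ∀ n, ω n = iteratedDeriv n F 0 := eq_iteratedDeriv_of_hasSum hsum
  have hcard := eventually_le_card_filter hd hdens
  set T : ℕ → Finset ℕ := fun N => (Finset.Icc 1 N).filter (· ∈ {n : ℕ | ‖ω n‖ = 1}) with hTdef
  have hT : ∀ N, T N ⊆ Finset.Icc 1 N := fun N => Finset.filter_subset _ _
  have hT1 : ∀ N, ∀ n ∈ T N, ‖iteratedDeriv n F 0‖ = 1 := by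
    intro N n hn
    rw [← hω]
    exact (Finset.mem_filter.1 hn).2
  have hne : ∃ z, F z ≠ 0 := by
    by_contra hall
    push Not at hall
    obtain ⟨N, hN, hN1⟩ := (hcard.and (Filter.eventually_ge_atTop 1)).exists
    have hN0 : (0 : ℝ) < N := by exact_mod_cast hN1
    have hpos : (0 : ℝ) < (T N).card := lt_of_lt_of_le (by positivity) hN
    obtain ⟨n, hn⟩ := Finset.card_pos.1 (by exact_mod_cast hpos)
    have h1 := hT1 N n hn
    rw [show F = fun _ => 0 from funext hall] at h1
    simp at h1
  have hfreq : ∃ᶠ R : ℝ in Filter.atTop, (zeroCount F R : ℝ) / R < χ :=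
    (Filter.frequently_lt_of_liminf_lt (by isBoundedDefault) hlt).mono fun R hR => by
      exact_mod_cast hR
  obtain ⟨h1, h2⟩ := unimodular_geometric_of_frequently hd hF.entire hT hT1 hcard
    (hmain F hF.entire T hT hT1 hcard hne (hF.growth 1 one_pos) hfreq)
  exact eq_mul_exp_of_geometric hsum (fun n => by rw [hω]; exact h1 n)
    (fun n => by rw [hω, hω, hω]; exact h2 n)
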